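/- **Conventions.** $T\vdash\varphi$ means that $\varphi$ is a consequence of $T$ in first-order logic with equality (it holds in every model of $T$, under every assignment of its free variables). An *$m$-dimensional relative translation* $\tau$ from a language $\mathcal L_1$ to a language $\mathcal L_2$ consists of an $\mathcal L_2$-formula $\delta(\vec x)$ in $m$ variables (the domain), a formula $\psi_R(\vec x_1,\dots,\vec x_n)$ for each $n$-ary relation symbol $R$ of $\mathcal L_1$ and for equality (with $n=2$), and a formula $\psi_f(\vec x_1,\dots,\vec x_n,\vec y)$ for each $n$-ary function symbol $f$ of $\mathcal L_1$ (constants have $n=0$), where all blocks of variables have length $m$. It extends to all formulas: $t^{\tau,\vec w}$ says that $\vec w$ is the value of the term $t$, that is, $x^{\tau,\vec w}$ is $\vec w=\vec x$, and $f(t_1,\dots,t_n)^{\tau,\vec w}$ is $\exists\vec w_1\dots\vec w_n\,[\bigwedge_i\delta(\vec w_i)\wedge\bigwedge_i t_i^{\tau,\vec w_i}\wedge\psi_f(\vec w_1,\dots,\vec w_n,\vec w)]$; $R(t_1,\dots,t_n)^\tau$ is $\exists\vec v_1\dots\vec v_n\,[\bigwedge_i\delta(\vec v_i)\wedge\bigwedge_i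 t_i^{\tau,\vec v_i}\wedge\psi_R(\vec v_1,\dots,\vec v_n)]$; $\tau$ commutes with the connectives; and quantifiers are relativized to $\delta$. An $\mathcal L_1$-theory $S$ is *interpreted by $\tau$ in* an $\mathcal L_2$-theory $T$ if $T\vdash\exists\vec x\,\delta(\vec x)$, $T\vdash\bigwedge_i\delta(\vec x_i)\to\exists!\vec y\,[\delta(\vec y)\wedge\psi_f(\vec x_1,\dots,\vec x_n,\vec y)]$ for each function symbol $f$ of $\mathcal L_1$, and $T\vdash\varphi^\tau$ for each axiom $\varphi$ of $S$ and each equality axiom $\varphi$ of $\mathcal L_1$. **The theories.** For a nonempty bit string $\alpha$, let $\overline\alpha$ be its canonical term, $\overline{\boldsymbol 0}=0$, $\overline{\boldsymbol 1}=1$, $\overline{\alpha\boldsymbol 0}=\overline\alpha\circ 0$, $\overline{\alpha\boldsymbol 1}=\overline\alpha\circ 1$, and let $\mathsf{Pref}(\alpha)$ be the set of its nonempty prefixes. $\overline{\mathsf{ID}}$ is the theory in the language $\{0,1,\circ,\preceq\}$ with the following axioms, universally quantified, where juxtaposition is $\circ$ and $\alpha$ ranges over the nonempty bit strings: $$(xy)z=x(yz),\quad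 x\ne y\to(x0\ne y0\wedge x1\ne y1),\quad x0\ne y1,\quad x\preceq\overline\alpha\leftrightarrow\bigvee_{\gamma\in\mathsf{Pref}(\alpha)}x=\overline\gamma,$$ $$x\ne y\to(0x\ne0y\wedge1x\ne1y),\quad 0x\ne1y.$$ $\mathsf{IQ}$ is the theory in the language $\{0,\mathrm S,+,\times,\le\}$ with the following axioms, universally quantified, where $n\in\mathbb N$ and $\overline n=\mathrm S^n0$: $$x\ne y\to \mathrm Sx\ne \mathrm Sy,\quad \mathrm Sx\ne0,\quad x\le\overline n\leftrightarrow\bigvee_{k\le n}x=\overline k,\quad x+0=x,\quad x+\mathrm Sy=\mathrm S(x+y),\quad x\times0=0,\quad x\times \mathrm Sy=x\times y+x.$$ $\mathsf{IQ}^{(2)}$ is $\mathsf{IQ}$ extended with the axioms (I) $x(y+z)=xy+xz$, (II) $(x+y)+z=x+(y+z)$, (III) $(xy)z=x(yz)$, (IV) $x+y=y+x$, (V) $xy=yx$, (VI) $x+z=y+z\to x=y$, (VII) $x+y=0\to(x=0\wedge y=0)$, (VIII) $xy=0\to(x=0\vee y=0)$. **The translations.** For a formula $N(x)$ in the language of $\mathsf{IQ}$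 with at most one free variable, let $\tau_N$ be the following $4$-dimensional translation of $\{0,1,\circ,\preceq\}$ into $\{0,\mathrm S,+,\times,\le\}$, where four variables are read as the entries of a $2\times2$ matrix. The domain consists of the matrices $\begin{pmatrix}x&y\\z&w\end{pmatrix}$ with $N(x),N(y),N(z),N(w)$ and $x\ne0$. Equality is translated as entrywise equality, $0$ as $\begin{pmatrix}1&0\\1&1\end{pmatrix}$, $1$ as $\begin{pmatrix}1&1\\0&1\end{pmatrix}$ (where $1=\mathrm S0$), and $\circ$ as matrix multiplication. Let $K$ be the class of the matrices $\begin{pmatrix}x&y\\z&w\end{pmatrix}$ that differ from the identity matrix and satisfy $xw=1+yz$. Then $A\preceq B$ is translated as: $A,B\in K$, and there is an entry $m$ of $B$ such that $b\le m$ for every entry $b$ of $B$ and either $A=B$, or $AC=B$ for some $C\in K$ with entries in $N$ such that all entries of $A$ and of $C$ are $\le m$. Let $\tau$ be $\tau_N$ for the trivially true $N$; its domain consists of all matrices with nonzero top-left entry. Finally, let $\rho_N$ be the one-dimensional translation of $\{0,\mathrm S,+,\times,\le\}$ into itself with domain $N$ that translates every symbol, and equality, as itself. **Theorem.** $\overline{\mathsf{ID}}$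 has a $4$-dimensional interpretation in $\mathsf{IQ}$. More precisely: 1. $\tau$ interprets $\overline{\mathsf{ID}}$ in $\mathsf{IQ}^{(2)}$. 2. There is a formula $N(x)$ in the language of $\mathsf{IQ}$ such that $\rho_N$ interprets $\mathsf{IQ}^{(2)}$ in $\mathsf{IQ}$ and $\tau_N$ interprets $\overline{\mathsf{ID}}$ in $\mathsf{IQ}$. -/

import Mathlib

open FirstOrder FirstOrder.Language

/-! ## Relative translations and interpretations

`T ⊨ᵇ φ` is Mathlib's consequence relation of first-order logic with equality: the formula `φ`
holds in all nonempty models of `T` under all assignments. By the completeness theorem this is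
`T ⊢ φ`. -/

/-- An `m`-dimensional, parameter-free, one-piece relative translation from `L₁` to `L₂`: a domain
formula, a formula for equality, one for each relation symbol and one for each function symbol
(constants are the function symbols of arity `0`). A variable of `L₁` becomes a block of `m`
variables of `L₂`; the variable `(j, i)` is the `i`-th entry of the `j`-th argument. In the formula
of a function symbol the block `Sum.inr` is the value. -/
structure RelTranslation (L₁ L₂ : FirstOrder.Language.{0, 0}) (m : ℕ) where
  dom : L₂.Formula (Fin m)
  eqv : L₂.Formula (Fin 2 × Fin m)
  rel : ∀ {n : ℕ}, L₁.Relations n → L₂.Formula (Fin n × Fin m)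
  func : ∀ {n : ℕ}, L₁.Functions n → L₂.Formula ((Fin n × Fin m) ⊕ Fin m)

namespace RelTranslation

variable {L₁ L₂ : FirstOrder.Language.{0, 0}} {m : ℕ}

/-- `δ(x_j)`, where `x_j` is the block of variables chosen by `g`. -/
def domAt {β : Type} (τ : RelTranslation L₁ L₂ m) (g : Fin m → β) : L₂.Formula β :=
  τ.dom.relabel g

/-- The formula `(t)^{τ, w}`, which says that the block `w` (the variables `Sum.inr _`) is the
value of the term `t`. -/
noncomputable def term {β : Type} (τ : RelTranslation L₁ L₂ m) :
    L₁.Term β → L₂.Formula ((β × Fin m) ⊕ Fin m)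
  | .var x => Formula.iInf fun i : Fin m =>
      Term.equal (Term.var (Sum.inr i)) (Term.var (Sum.inl (x, i)))
  | @Term.func _ _ n f ts => Formula.iExs (Fin n × Fin m)
      ((Formula.iInf fun j : Fin n => τ.domAt fun i => Sum.inr (j, i)) ⊓
        (Formula.iInf fun j : Fin n => (τ.term (ts j)).relabel
          (Sum.elim (fun p => Sum.inl (Sum.inl p)) (fun i => Sum.inr (j, i)))) ⊓
        (τ.func f).relabel (Sum.elim Sum.inr (fun i => Sum.inl (Sum.inr i))))

/-- The translation of an atomic formula with arguments `ts`, where `ψ` is the formula assigned to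
its relation symbol. -/
noncomputable def atom {β : Type} {n : ℕ} (τ : RelTranslation L₁ L₂ m)
    (ψ : L₂.Formula (Fin n × Fin m)) (ts : Fin n → L₁.Term β) : L₂.Formula (β × Fin m) :=
  Formula.iExs (Fin n × Fin m)
    ((Formula.iInf fun j : Fin n => τ.domAt fun i => Sum.inr (j, i)) ⊓
      (Formula.iInf fun j : Fin n => (τ.term (ts j)).relabel
        (Sum.elim Sum.inl (fun i => Sum.inr (j, i)))) ⊓
      ψ.relabel Sum.inr)

/-- The translation `φ^τ` of a formula. It commutes with `⊥`, `→`, and relativizes `∀` to the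
domain; the other connectives and `∃` are abbreviations in terms of these. -/
noncomputable def formula {α : Type} (τ : RelTranslation L₁ L₂ m) :
    {n : ℕ} → L₁.BoundedFormula α n → L₂.Formula ((α ⊕ Fin n) × Fin m)
  | _, .falsum => ⊥
  | _, .equal t₁ t₂ => τ.atom τ.eqv ![t₁, t₂]
  | _, .rel R ts => τ.atom (τ.rel R) ts
  | _, .imp φ ψ => (τ.formula φ).imp (τ.formula ψ)
  | n, .all φ => Formula.iAlls (Fin m)
      ((τ.domAt Sum.inr).imp ((τ.formula φ).relabel fun p =>
        match p with
        | (Sum.inl a, i) => Sum.inl (Sum.inl a, i)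
        | (Sum.inr k, i) => Fin.lastCases (motive := fun _ => ((α ⊕ Fin n) × Fin m) ⊕ Fin m)
            (Sum.inr i) (fun k' => Sum.inl (Sum.inr k', i)) k))

end RelTranslation

/-- The equality axioms of a language: equality is an equivalence relation that is a congruence
for all function and relation symbols. -/
inductive EqAxiom (L : FirstOrder.Language.{0, 0}) : L.Sentence → Prop
  | refl : EqAxiom L (∀' ((&0) =' (&0)))
  | symm : EqAxiom L (∀' ∀' (((&0) =' (&1)) ⟹ ((&1) =' (&0))))
  | trans : EqAxiom L (∀' ∀' ∀' (((&0) =' (&1)) ⟹ (((&1) =' (&2)) ⟹ ((&0) =' (&2)))))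
  | func {n : ℕ} (f : L.Functions n) : EqAxiom L (BoundedFormula.alls (n := n + n)
      ((BoundedFormula.iInf fun i : Fin n => (&(Fin.castAdd n i)) =' (&(Fin.natAdd n i))) ⟹
        ((Term.func f fun i => &(Fin.castAdd n i)) =' (Term.func f fun i => &(Fin.natAdd n i)))))
  | rel {n : ℕ} (R : L.Relations n) : EqAxiom L (BoundedFormula.alls (n := n + n)
      ((BoundedFormula.iInf fun i : Fin n => (&(Fin.castAdd n i)) =' (&(Fin.natAdd n i))) ⟹
        ((R.boundedFormula fun i => &(Fin.castAdd n i)) ⟹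
          (R.boundedFormula fun i => &(Fin.natAdd n i)))))

/-- `τ` defines a relative interpretation of the theory `S` in the theory `T`. -/
structure IsInterpretation {L₁ L₂ : FirstOrder.Language.{0, 0}} {m : ℕ} (τ : RelTranslation L₁ L₂ m)
    (S : L₁.Theory) (T : L₂.Theory) : Prop where
  dom_nonempty : T ⊨ᵇ (Formula.iExs (Fin m) (τ.domAt Sum.inr) : L₂.Formula Empty)
  func_total : ∀ {n : ℕ} (f : L₁.Functions n), T ⊨ᵇ
    ((Formula.iInf fun j : Fin n => τ.domAt fun i => (j, i)).imp
      (Formula.iExsUnique (Fin m) (τ.domAt Sum.inr ⊓ τ.func f)))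
  equality : ∀ φ : L₁.Sentence, EqAxiom L₁ φ → T ⊨ᵇ τ.formula φ
  axioms : ∀ φ ∈ S, T ⊨ᵇ τ.formula φ

/-- `S` has an `m`-dimensional interpretation in `T`. -/
def HasInterpretation (m : ℕ) {L₁ L₂ : FirstOrder.Language.{0, 0}} (S : L₁.Theory) (T : L₂.Theory) : Prop :=
  ∃ τ : RelTranslation L₁ L₂ m, IsInterpretation τ S T

/-- The one-dimensional translation of a language into itself that only relativizes quantifiers to
the class `N`. -/
def relativization {L : FirstOrder.Language.{0, 0}} (N : L.Formula (Fin 1)) : RelTranslation L L 1 where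
  dom := N
  eqv := Term.equal (Term.var (0, 0)) (Term.var (1, 0))
  rel R := R.formula fun j => Term.var (j, 0)
  func f := Term.equal (Term.var (Sum.inr 0)) (Term.func f fun j => Term.var (Sum.inl (j, 0)))

/-- The disjunction of a list of formulas. -/
def bigOr {L : FirstOrder.Language.{0, 0}} {α : Type} {n : ℕ} (l : List (L.BoundedFormula α n)) :
    L.BoundedFormula α n :=
  l.foldr (· ⊔ ·) ⊥

/-! ## The language `{0, 1, ∘, ≼}` and the theory `ID̄` -/

inductive BTFunc : ℕ → Type
  | zero : BTFunc 0
  | one : BTFunc 0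
  | conc : BTFunc 2

inductive BTRel : ℕ → Type
  | pref : BTRel 2

/-- The language `{0, 1, ∘, ≼}` of concatenation theory. -/
def LBT : FirstOrder.Language.{0, 0} := ⟨BTFunc, BTRel⟩

namespace LBT

variable {α : Type}

/-- The constant symbols `0` and `1`, as the letters `false` and `true`. -/
def bit : Bool → LBT.Term α
  | false => Term.func (L := LBT) BTFunc.zero ![]
  | true => Term.func (L := LBT) BTFunc.one ![]

def conc (s t : LBT.Term α) : LBT.Term α := Term.func (L := LBT) BTFunc.conc ![s, t]

def pref {n : ℕ} (s t : LBT.Term (α ⊕ Fin n)) : LBT.BoundedFormula α n :=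
  BoundedFormula.rel (L := LBT) BTRel.pref ![s, t]

/-- The biteral of the nonempty bit string with first letter `b` and remaining letters `l`,
bracketed to the left. -/
def biteral (b : Bool) (l : List Bool) : LBT.Term α :=
  l.foldl (fun t c => conc t (bit c)) (bit b)

/-- `(x y) z = x (y z)` -/
def ax1 : LBT.Sentence := ∀' ∀' ∀' (conc (conc (&0) (&1)) (&2) =' conc (&0) (conc (&1) (&2)))

/-- `x ≠ y → (x 0 ≠ y 0 ∧ x 1 ≠ y 1)` -/
def ax2 : LBT.Sentence := ∀' ∀' (∼((&0) =' (&1)) ⟹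
  (∼(conc (&0) (bit false) =' conc (&1) (bit false)) ⊓
    ∼(conc (&0) (bit true) =' conc (&1) (bit true))))

/-- `x 0 ≠ y 1` -/
def ax3 : LBT.Sentence := ∀' ∀' ∼(conc (&0) (bit false) =' conc (&1) (bit true))

/-- `x ≼ α ↔ ⋁ x = γ`, for the nonempty bit string `α` with first letter `b` and remaining
letters `l`, where `γ` ranges over the nonempty prefixes of `α`. -/
def ax4 (b : Bool) (l : List Bool) : LBT.Sentence :=
  ∀' (pref (&0) (biteral b l) ⇔ bigOr (l.inits.map fun g => (&0) =' biteral b g))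

/-- `x ≠ y → (0 x ≠ 0 y ∧ 1 x ≠ 1 y)` -/
def ax5 : LBT.Sentence := ∀' ∀' (∼((&0) =' (&1)) ⟹
  (∼(conc (bit false) (&0) =' conc (bit false) (&1)) ⊓
    ∼(conc (bit true) (&0) =' conc (bit true) (&1))))

/-- `0 x ≠ 1 y` -/
def ax6 : LBT.Sentence := ∀' ∀' ∼(conc (bit false) (&0) =' conc (bit true) (&1))

end LBT

/-- The theory `ID̄`. -/
def IDbar : LBT.Theory :=
  {LBT.ax1, LBT.ax2, LBT.ax3, LBT.ax5, LBT.ax6} ∪ {φ | ∃ b l, φ = LBT.ax4 b l}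

/-! ## The language `{0, S, +, ×, ≤}` and the theories `IQ` and `IQ⁽²⁾` -/

inductive NTFunc : ℕ → Type
  | zero : NTFunc 0
  | succ : NTFunc 1
  | add : NTFunc 2
  | mul : NTFunc 2

inductive NTRel : ℕ → Type
  | le : NTRel 2

/-- The language `{0, S, +, ×, ≤}` of arithmetic with an order symbol. -/
def LNT : FirstOrder.Language.{0, 0} := ⟨NTFunc, NTRel⟩

namespace LNT

variable {α : Type}

def zero : LNT.Term α := Term.func (L := LNT) NTFunc.zero ![]

def succ (t : LNT.Term α) : LNT.Term α := Term.func (L := LNT) NTFunc.succ ![t]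

def add (s t : LNT.Term α) : LNT.Term α := Term.func (L := LNT) NTFunc.add ![s, t]

def mul (s t : LNT.Term α) : LNT.Term α := Term.func (L := LNT) NTFunc.mul ![s, t]

def le {n : ℕ} (s t : LNT.Term (α ⊕ Fin n)) : LNT.BoundedFormula α n :=
  BoundedFormula.rel (L := LNT) NTRel.le ![s, t]

def numeral : ℕ → LNT.Term α
  | 0 => zero
  | n + 1 => succ (numeral n)

/-- `x ≠ y → S x ≠ S y` -/
def q1 : LNT.Sentence := ∀' ∀' (∼((&0) =' (&1)) ⟹ ∼(succ (&0) =' succ (&1)))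

/-- `S x ≠ 0` -/
def q2 : LNT.Sentence := ∀' ∼(succ (&0) =' zero)

/-- `x ≤ n ↔ ⋁ x = k`, where `k` ranges over the numbers `k ≤ n`. -/
def iq3 (n : ℕ) : LNT.Sentence :=
  ∀' (le (&0) (numeral n) ⇔ bigOr ((List.range (n + 1)).map fun k => (&0) =' numeral k))

/-- `x + 0 = x` -/
def q4 : LNT.Sentence := ∀' (add (&0) zero =' (&0))

/-- `x + S y = S (x + y)` -/
def q5 : LNT.Sentence := ∀' ∀' (add (&0) (succ (&1)) =' succ (add (&0) (&1)))

/-- `x × 0 = 0` -/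
def q6 : LNT.Sentence := ∀' (mul (&0) zero =' zero)

/-- `x × S y = x × y + x` -/
def q7 : LNT.Sentence := ∀' ∀' (mul (&0) (succ (&1)) =' add (mul (&0) (&1)) (&0))

/-- `x (y + z) = x y + x z` -/
def leftDistrib : LNT.Sentence :=
  ∀' ∀' ∀' (mul (&0) (add (&1) (&2)) =' add (mul (&0) (&1)) (mul (&0) (&2)))

/-- `(x + y) + z = x + (y + z)` -/
def addAssoc : LNT.Sentence :=
  ∀' ∀' ∀' (add (add (&0) (&1)) (&2) =' add (&0) (add (&1) (&2)))

/-- `(x y) z = x (y z)` -/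
def mulAssoc : LNT.Sentence :=
  ∀' ∀' ∀' (mul (mul (&0) (&1)) (&2) =' mul (&0) (mul (&1) (&2)))

/-- `x + y = y + x` -/
def addComm : LNT.Sentence := ∀' ∀' (add (&0) (&1) =' add (&1) (&0))

/-- `x y = y x` -/
def mulComm : LNT.Sentence := ∀' ∀' (mul (&0) (&1) =' mul (&1) (&0))

/-- `x + z = y + z → x = y` -/
def addRightCancel : LNT.Sentence :=
  ∀' ∀' ∀' ((add (&0) (&2) =' add (&1) (&2)) ⟹ ((&0) =' (&1)))

/-- `x + y = 0 → (x = 0 ∧ y = 0)` -/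
def nonneg : LNT.Sentence :=
  ∀' ∀' ((add (&0) (&1) =' zero) ⟹ (((&0) =' zero) ⊓ ((&1) =' zero)))

/-- `x y = 0 → (x = 0 ∨ y = 0)` -/
def noZeroDivisors : LNT.Sentence :=
  ∀' ∀' ((mul (&0) (&1) =' zero) ⟹ (((&0) =' zero) ⊔ ((&1) =' zero)))

/-! ### `2 × 2` matrices of terms

The entries `0, 1, 2, 3` are top left, top right, bottom left, bottom right. -/

def matId : Fin 4 → LNT.Term α := ![succ zero, zero, zero, succ zero]

/-- The matrix of the letter `0`. -/
def matZero : Fin 4 → LNT.Term α := ![succ zero, zero, succ zero, succ zero]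

/-- The matrix of the letter `1`. -/
def matOne : Fin 4 → LNT.Term α := ![succ zero, succ zero, zero, succ zero]

def matMul (a b : Fin 4 → LNT.Term α) : Fin 4 → LNT.Term α :=
  ![add (mul (a 0) (b 0)) (mul (a 1) (b 2)), add (mul (a 0) (b 1)) (mul (a 1) (b 3)),
    add (mul (a 2) (b 0)) (mul (a 3) (b 2)), add (mul (a 2) (b 1)) (mul (a 3) (b 3))]

/-- `A = B`, entry by entry. -/
noncomputable def matEq (a b : Fin 4 → LNT.Term α) : LNT.Formula α :=
  Formula.iInf fun i : Fin 4 => Term.equal (a i) (b i)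

/-- `s ≤ t`, as a formula without bound variables. -/
def leF (s t : LNT.Term α) : LNT.Formula α := Relations.formula (L := LNT) NTRel.le ![s, t]

/-- `A` is not the identity matrix, and `a₁ a₄ = 1 + a₂ a₃`. -/
noncomputable def inK (a : Fin 4 → LNT.Term α) : LNT.Formula α :=
  ∼(matEq a matId) ⊓ Term.equal (mul (a 0) (a 3)) (add (succ zero) (mul (a 1) (a 2)))

/-- All entries of the matrix of variables `g` are in the class `N`. -/
noncomputable def entriesIn (N : LNT.Formula (Fin 1)) (g : Fin 4 → α) : LNT.Formula α :=
  Formula.iInf fun i : Fin 4 => N.relabel fun _ => g i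

/-- `A ≼ B`: both matrices are in `K`, and some entry `m` of `B` is the largest entry of `B` such
that `A = B`, or `A C = B` for some matrix `C` in `K` with entries in `N`, where all entries of `A`
and of `C` are `≤ m`. The variables `(0, i)` and `(1, i)` are the entries of `A` and `B`; below
the quantifier over `C` the variables `Sum.inr i` are the entries of `C`. -/
noncomputable def matPref (N : LNT.Formula (Fin 1)) : LNT.Formula (Fin 2 × Fin 4) :=
  inK (fun i => Term.var (0, i)) ⊓ inK (fun i => Term.var (1, i)) ⊓
    Formula.iSup fun m : Fin 4 =>
      (Formula.iInf fun i : Fin 4 => leF (Term.var (1, i)) (Term.var (1, m))) ⊓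
        (matEq (fun i => Term.var (0, i)) (fun i => Term.var (1, i)) ⊔
          Formula.iExs (Fin 4)
            (entriesIn N Sum.inr ⊓ inK (fun i => Term.var (Sum.inr i)) ⊓
              (Formula.iInf fun i : Fin 4 =>
                leF (Term.var (Sum.inl (0, i))) (Term.var (Sum.inl (1, m))) ⊓
                  leF (Term.var (Sum.inr i)) (Term.var (Sum.inl (1, m)))) ⊓
              matEq
                (matMul (fun i => Term.var (Sum.inl (0, i))) (fun i => Term.var (Sum.inr i)))
                (fun i => Term.var (Sum.inl (1, i)))))

end LNT

/-- The theory `IQ`. -/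
def IQ : LNT.Theory :=
  {LNT.q1, LNT.q2, LNT.q4, LNT.q5, LNT.q6, LNT.q7} ∪ {φ | ∃ n, φ = LNT.iq3 n}

/-- The theory `IQ⁽²⁾`: the extension of `IQ` by the commutative-semiring axioms. -/
def IQ2 : LNT.Theory :=
  IQ ∪ {LNT.leftDistrib, LNT.addAssoc, LNT.mulAssoc, LNT.addComm, LNT.mulComm,
    LNT.addRightCancel, LNT.nonneg, LNT.noZeroDivisors}

/-- The function symbols of `{0, 1, ∘, ≼}` read as matrices: the value `Sum.inr _` is the matrix
of the letter, or the product of the two arguments. -/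
noncomputable def matFunc : {n : ℕ} → BTFunc n → LNT.Formula ((Fin n × Fin 4) ⊕ Fin 4)
  | _, .zero => LNT.matEq (fun i => Term.var (Sum.inr i)) LNT.matZero
  | _, .one => LNT.matEq (fun i => Term.var (Sum.inr i)) LNT.matOne
  | _, .conc => LNT.matEq (fun i => Term.var (Sum.inr i))
      (LNT.matMul (fun i => Term.var (Sum.inl (0, i))) (fun i => Term.var (Sum.inl (1, i))))

noncomputable def matRel (N : LNT.Formula (Fin 1)) :
    {n : ℕ} → BTRel n → LNT.Formula (Fin n × Fin 4)
  | _, .pref => LNT.matPref N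

/-- The four-dimensional translation that reads strings as `2 × 2` matrices. The domain consists of
the matrices with entries in the class `N` and nonzero top left entry; equality is translated as
equality. -/
noncomputable def matrixTranslation (N : LNT.Formula (Fin 1)) : RelTranslation LBT LNT 4 where
  dom := LNT.entriesIn N id ⊓ ∼(Term.equal (Term.var 0) LNT.zero)
  eqv := LNT.matEq (fun i => Term.var (0, i)) (fun i => Term.var (1, i))
  rel R := matRel N R
  func f := matFunc f

/-! ## Internal models

A translation read in a structure `M` whose domain carries a structure for the first language. -/

namespace RelTranslation

variable {L₁ L₂ : FirstOrder.Language.{0, 0}} {m : ℕ} {M D : Type}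

/-- The structure `D` is the one that `τ` defines in `M`, where `e d` is the block of elements
of `M` that codes `d`. -/
structure IsInternalModel [L₂.Structure M] [L₁.Structure D] (τ : RelTranslation L₁ L₂ m)
    (e : D → Fin m → M) : Prop where
  injective : Function.Injective e
  dom : ∀ w, τ.dom.Realize w ↔ ∃ d, e d = w
  eqv : ∀ ds : Fin 2 → D, τ.eqv.Realize (fun p => e (ds p.1) p.2) ↔ ds 0 = ds 1
  rel : ∀ {n : ℕ} (R : L₁.Relations n) (ds : Fin n → D),
    (τ.rel R).Realize (fun p => e (ds p.1) p.2) ↔ Structure.RelMap R ds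
  func : ∀ {n : ℕ} (f : L₁.Functions n) (ds : Fin n → D) (d : D),
    (τ.func f).Realize (Sum.elim (fun p => e (ds p.1) p.2) (e d)) ↔ Structure.funMap f ds = d

namespace IsInternalModel

variable [L₂.Structure M] [L₁.Structure D] {τ : RelTranslation L₁ L₂ m} {e : D → Fin m → M}

theorem realize_domAt (h : IsInternalModel τ e) {β : Type} (g : Fin m → β) (v : β → M) :
    (τ.domAt g).Realize v ↔ ∃ d, e d = fun i => v (g i) := by
  rw [domAt, Formula.realize_relabel, h.dom]
  rfl

theorem exists_blocks (h : IsInternalModel τ e) {β : Type} {n : ℕ} (g : Fin n × Fin m → β)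
    (v : β → M) (P : Prop) :
    (∀ j, (τ.domAt fun i => g (j, i)).Realize v) ∧ P ↔
      (∃ ds : Fin n → D, (fun p => e (ds p.1) p.2) = fun p => v (g p)) ∧ P := by
  refine and_congr_left fun _ => ?_
  simp only [h.realize_domAt]
  constructor
  · intro H
    choose ds hds using H
    exact ⟨ds, funext fun p => congrFun (hds p.1) p.2⟩
  · rintro ⟨ds, hds⟩ j
    exact ⟨ds j, funext fun i => congrFun hds (j, i)⟩

theorem realize_term (h : IsInternalModel τ e) {β : Type} (v : β → D) :
    ∀ (t : L₁.Term β) (d : D),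
      (τ.term t).Realize (Sum.elim (fun p => e (v p.1) p.2) (e d)) ↔ t.realize v = d
  | .var x, d => by
    simp only [RelTranslation.term, Formula.realize_iInf, Formula.realize_equal, Term.realize_var,
      Sum.elim_inl, Sum.elim_inr]
    exact ⟨fun H => h.injective (funext fun i => (H i).symm), fun H i => by rw [H]⟩
  | .func (l := n) f ts, d => by
    simp only [RelTranslation.term, Formula.realize_iExs, Formula.realize_inf, Formula.realize_iInf,
      Formula.realize_relabel, and_assoc, Term.realize_func]
    constructor
    · rintro ⟨w, H⟩
      obtain ⟨⟨ds, hds⟩, ht, hf⟩ := (h.exists_blocks Sum.inr _ _).1 H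
      replace hds : _ = w := hds
      subst hds
      have key : (fun j => (ts j).realize v) = ds := funext fun j => by
        rw [← h.realize_term v (ts j)]
        convert ht j using 1
        ext p; rcases p with p | p <;> rfl
      rw [key, ← h.func]
      convert hf using 1
      ext p; rcases p with p | p <;> rfl
    · intro H
      refine ⟨fun p => e ((ts p.1).realize v) p.2, (h.exists_blocks Sum.inr _ _).2
        ⟨⟨fun j => (ts j).realize v, rfl⟩, fun j => ?_, ?_⟩⟩
      · convert (h.realize_term v (ts j) _).2 rfl using 1
        ext p; rcases p with p | p <;> rfl
      · convert (h.func _ _ _).2 H using 1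
        ext p; rcases p with p | p <;> rfl

theorem realize_atom (h : IsInternalModel τ e) {β : Type} (v : β → D) {n : ℕ}
    (ψ : L₂.Formula (Fin n × Fin m)) (ts : Fin n → L₁.Term β) :
    (τ.atom ψ ts).Realize (fun p => e (v p.1) p.2) ↔
      ψ.Realize fun p => e ((ts p.1).realize v) p.2 := by
  simp only [RelTranslation.atom, Formula.realize_iExs, Formula.realize_inf, Formula.realize_iInf,
    Formula.realize_relabel, and_assoc]
  constructor
  · rintro ⟨w, H⟩
    obtain ⟨⟨ds, hds⟩, ht, hf⟩ := (h.exists_blocks Sum.inr _ _).1 H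
    replace hds : _ = w := hds
    subst hds
    have key : ds = fun j => (ts j).realize v := funext fun j => by
      refine Eq.symm ((h.realize_term v (ts j) _).1 ?_)
      convert ht j using 1
      ext p; rcases p with p | p <;> rfl
    rw [key] at hf
    exact hf
  · intro H
    refine ⟨fun p => e ((ts p.1).realize v) p.2, (h.exists_blocks Sum.inr _ _).2
      ⟨⟨fun j => (ts j).realize v, rfl⟩, fun j => ?_, H⟩⟩
    convert (h.realize_term v (ts j) _).2 rfl using 1
    ext p; rcases p with p | p <;> rfl

theorem realize_formula (h : IsInternalModel τ e) {α : Type} {n : ℕ} (φ : L₁.BoundedFormula α n)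
    (v : α → D) (xs : Fin n → D) :
    (τ.formula φ).Realize (fun p => e (Sum.elim v xs p.1) p.2) ↔ φ.Realize v xs := by
  induction φ with
  | falsum => exact Iff.rfl
  | equal t₁ t₂ =>
    rw [RelTranslation.formula, h.realize_atom, h.eqv fun j => (![t₁, t₂] j).realize _]
    rfl
  | rel R ts =>
    rw [RelTranslation.formula, h.realize_atom, h.rel R fun j => (ts j).realize _]
    rfl
  | imp φ ψ ih₁ ih₂ =>
    rw [RelTranslation.formula, Formula.realize_imp, ih₁, ih₂, BoundedFormula.realize_imp]
  | all φ ih =>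
    rw [RelTranslation.formula, Formula.realize_iAlls, BoundedFormula.realize_all]
    simp only [Formula.realize_imp, h.realize_domAt, Formula.realize_relabel, Sum.elim_inr]
    have key : ∀ d, ((fun a => Sum.elim (fun p : (α ⊕ Fin _) × Fin m => e (Sum.elim v xs p.1) p.2)
        (e d) a) ∘ fun p : (α ⊕ Fin (_ + 1)) × Fin m => match p with
        | (Sum.inl a, i) => Sum.inl (Sum.inl a, i)
        | (Sum.inr k, i) => Fin.lastCases (motive := fun _ => ((α ⊕ Fin _) × Fin m) ⊕ Fin m)
            (Sum.inr i) (fun k' => Sum.inl (Sum.inr k', i)) k) =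
        fun p => e (Sum.elim v (Fin.snoc xs d) p.1) p.2 := by
      intro d
      ext ⟨k | k, i⟩
      · rfl
      · refine Fin.lastCases ?_ (fun k => ?_) k <;> simp
    constructor
    · intro H d
      rw [← ih, ← key]
      exact H (e d) ⟨d, rfl⟩
    · rintro H w ⟨d, hd⟩
      obtain rfl : e d = w := hd
      have := H d
      rw [← ih, ← key] at this
      exact this

theorem realize_sentence (h : IsInternalModel τ e) (φ : L₁.Sentence)
    (w : (Empty ⊕ Fin 0) × Fin m → M) : (τ.formula φ).Realize w ↔ D ⊨ φ := by
  rw [Sentence.Realize, Formula.Realize, Formula.Realize, ← h.realize_formula, Formula.Realize]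
  refine iff_of_eq (congrArg (fun w => BoundedFormula.Realize _ w _) (funext fun p => ?_))
  rcases p with ⟨k | k, _⟩
  exacts [k.elim, k.elim0]

end IsInternalModel

end RelTranslation

theorem EqAxiom.realize {L : FirstOrder.Language.{0, 0}} {φ : L.Sentence} (h : EqAxiom L φ)
    (D : Type) [L.Structure D] : D ⊨ φ := by
  cases h with
  | refl => simp [Sentence.Realize, Formula.Realize]
  | symm =>
    simp only [Sentence.Realize, Formula.Realize, BoundedFormula.realize_all,
      BoundedFormula.realize_imp, BoundedFormula.realize_bdEqual]
    exact fun _ _ H => H.symm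
  | trans =>
    simp only [Sentence.Realize, Formula.Realize, BoundedFormula.realize_all,
      BoundedFormula.realize_imp, BoundedFormula.realize_bdEqual]
    exact fun _ _ _ H₁ H₂ => H₁.trans H₂
  | func f =>
    simp only [Sentence.Realize, BoundedFormula.realize_alls,
      BoundedFormula.realize_imp, BoundedFormula.realize_bdEqual, BoundedFormula.realize_iInf,
      Term.realize_func]
    exact fun xs H => congrArg _ (funext H)
  | rel R =>
    simp only [Sentence.Realize, BoundedFormula.realize_alls,
      BoundedFormula.realize_imp, BoundedFormula.realize_bdEqual, BoundedFormula.realize_iInf,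
      BoundedFormula.realize_rel]
    exact fun xs H hR => (congrArg _ (funext H)).mp hR

/-- A translation interprets `S` in `T` if it defines a nonempty model of `S` in every model
of `T`. -/
theorem IsInterpretation.of_internalModel {L₁ L₂ : FirstOrder.Language.{0, 0}} {m : ℕ}
    {τ : RelTranslation L₁ L₂ m} {S : L₁.Theory} {T : L₂.Theory}
    (H : ∀ (M : Type) [L₂.Structure M] [M ⊨ T], ∃ (D : Type) (_ : L₁.Structure D)
      (e : D → Fin m → M), τ.IsInternalModel e ∧ Nonempty D ∧ D ⊨ S) :
    IsInterpretation τ S T where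
  dom_nonempty := by
    rw [Theory.models_formula_iff]
    intro M v
    obtain ⟨D, _, e, h, ⟨d⟩, _⟩ := H M
    rw [Formula.realize_iExs]
    exact ⟨e d, (h.realize_domAt _ _).2 ⟨d, rfl⟩⟩
  func_total {n} f := by
    intro M v xs
    obtain ⟨D, _, e, h, _, _⟩ := H M
    obtain rfl : xs = default := Subsingleton.elim _ _
    change Formula.Realize _ v
    rw [Formula.realize_imp, Formula.realize_iInf, Formula.realize_iExsUnique]
    intro hv
    obtain ⟨⟨ds, hds⟩, -⟩ := (h.exists_blocks id v True).1 ⟨hv, trivial⟩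
    obtain rfl : _ = v := hds
    simp only [Formula.realize_inf, h.realize_domAt, Sum.elim_inr]
    refine ⟨e (Structure.funMap f ds), ⟨⟨_, rfl⟩, (h.func _ _ _).2 rfl⟩, ?_⟩
    rintro w ⟨⟨d, hw⟩, hd⟩
    obtain rfl : e d = w := hw
    exact congrArg e ((h.func _ _ _).1 hd).symm
  equality φ hφ := by
    rw [Theory.models_formula_iff]
    intro M v
    obtain ⟨D, _, e, h, _, _⟩ := H M
    exact (h.realize_sentence φ v).2 (hφ.realize D)
  axioms φ hφ := by
    rw [Theory.models_formula_iff]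
    intro M v
    obtain ⟨D, _, e, h, _, hS⟩ := H M
    exact (h.realize_sentence φ v).2 (hS.realize_of_mem φ hφ)

/-! ## Models of arithmetic -/

namespace LNT

section Operations

variable {M : Type} [LNT.Structure M]

instance (priority := low) : Zero M := ⟨Structure.funMap (L := LNT) NTFunc.zero ![]⟩

instance (priority := low) : Add M := ⟨fun x y => Structure.funMap (L := LNT) NTFunc.add ![x, y]⟩

instance (priority := low) : Mul M := ⟨fun x y => Structure.funMap (L := LNT) NTFunc.mul ![x, y]⟩

/-- The interpretation of the symbol `S`. -/
def succFun (x : M) : M := Structure.funMap (L := LNT) NTFunc.succ ![x]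

/-- The interpretation of the symbol `≤`. -/
def leRel (x y : M) : Prop := Structure.RelMap (L := LNT) NTRel.le ![x, y]

variable (M) in
/-- The values of the numerals. -/
def num : ℕ → M
  | 0 => 0
  | n + 1 => succFun (num n)

theorem funMap_zero (x : Fin 0 → M) : Structure.funMap (L := LNT) NTFunc.zero x = 0 :=
  congrArg _ (Subsingleton.elim _ _)

theorem funMap_succ (x : Fin 1 → M) :
    Structure.funMap (L := LNT) NTFunc.succ x = succFun (x 0) :=
  congrArg _ (funext fun i => by fin_cases i; rfl)

theorem funMap_add (x : Fin 2 → M) : Structure.funMap (L := LNT) NTFunc.add x = x 0 + x 1 :=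
  congrArg _ (funext fun i => by fin_cases i <;> rfl)

theorem funMap_mul (x : Fin 2 → M) : Structure.funMap (L := LNT) NTFunc.mul x = x 0 * x 1 :=
  congrArg _ (funext fun i => by fin_cases i <;> rfl)

theorem relMap_le (x : Fin 2 → M) :
    Structure.RelMap (L := LNT) NTRel.le x ↔ leRel (x 0) (x 1) :=
  iff_of_eq (congrArg _ (funext fun i => by fin_cases i <;> rfl))

variable {α : Type} (v : α → M)

@[simp] theorem realize_zero : (zero : LNT.Term α).realize v = 0 := funMap_zero _

@[simp] theorem realize_succ (t : LNT.Term α) : (succ t).realize v = succFun (t.realize v) :=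
  funMap_succ _

@[simp] theorem realize_add (s t : LNT.Term α) :
    (add s t).realize v = s.realize v + t.realize v := funMap_add _

@[simp] theorem realize_mul (s t : LNT.Term α) :
    (mul s t).realize v = s.realize v * t.realize v := funMap_mul _

@[simp] theorem realize_numeral (n : ℕ) : (numeral n : LNT.Term α).realize v = num M n := by
  induction n with
  | zero => exact realize_zero v
  | succ n ih => rw [numeral, realize_succ, ih, num]

@[simp] theorem realize_le {n : ℕ} (s t : LNT.Term (α ⊕ Fin n)) (xs : Fin n → M) :
    (le s t).Realize v xs ↔ leRel (s.realize (Sum.elim v xs)) (t.realize (Sum.elim v xs)) :=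
  relMap_le _

@[simp] theorem realize_leF (s t : LNT.Term α) :
    (leF s t).Realize v ↔ leRel (s.realize v) (t.realize v) :=
  (Formula.realize_rel (L := LNT)).trans (relMap_le _)

end Operations

theorem _root_.realize_bigOr {L : FirstOrder.Language.{0, 0}} {M α : Type} [L.Structure M] {n : ℕ}
    (l : List (L.BoundedFormula α n)) (v : α → M) (xs : Fin n → M) :
    (bigOr l).Realize v xs ↔ ∃ φ ∈ l, φ.Realize v xs :=
  BoundedFormula.realize_foldr_sup l v xs

variable (M : Type) [LNT.Structure M]

/-- The axioms of `IQ`, read in `M`. -/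
structure IsIQ : Prop where
  succ_inj : ∀ x y : M, succFun x = succFun y → x = y
  succ_ne_zero : ∀ x : M, succFun x ≠ 0
  le_iff : ∀ (n : ℕ) (x : M), leRel x (num M n) ↔ ∃ k ≤ n, x = num M k
  add_zero : ∀ x : M, x + 0 = x
  add_succ : ∀ x y : M, x + succFun y = succFun (x + y)
  mul_zero : ∀ x : M, x * 0 = 0
  mul_succ : ∀ x y : M, x * succFun y = x * y + x

/-- The axioms (I)–(VIII) of `IQ⁽²⁾`, read in `M`. -/
structure IsSemiring : Prop where
  left_distrib : ∀ x y z : M, x * (y + z) = x * y + x * z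
  add_assoc : ∀ x y z : M, x + y + z = x + (y + z)
  mul_assoc : ∀ x y z : M, x * y * z = x * (y * z)
  add_comm : ∀ x y : M, x + y = y + x
  mul_comm : ∀ x y : M, x * y = y * x
  add_right_cancel : ∀ x y z : M, x + z = y + z → x = y
  eq_zero_of_add : ∀ x y : M, x + y = 0 → x = 0 ∧ y = 0
  eq_zero_of_mul : ∀ x y : M, x * y = 0 → x = 0 ∨ y = 0

theorem model_IQ_iff : M ⊨ IQ ↔ IsIQ M := by
  have key : M ⊨ IQ ↔ (∀ x y : M, x ≠ y → succFun x ≠ succFun y) ∧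
      (∀ x : M, succFun x ≠ 0) ∧ (∀ x : M, x + 0 = x) ∧
      (∀ x y : M, x + succFun y = succFun (x + y)) ∧ (∀ x : M, x * 0 = 0) ∧
      (∀ x y : M, x * succFun y = x * y + x) ∧
      ∀ (n : ℕ) (x : M), leRel x (num M n) ↔ ∃ k < n + 1, x = num M k := by
    simp only [Theory.model_iff, IQ, Set.mem_union, Set.mem_insert_iff, Set.mem_singleton_iff,
      Set.mem_ofPred_eq, or_imp, forall_and, forall_eq, forall_exists_index, and_assoc]
    rw [forall_comm]
    simp only [forall_eq]
    simp [q1, q2, q4, q5, q6, q7, iq3, Sentence.Realize, Formula.Realize, realize_bigOr, Fin.snoc]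
  rw [key]
  constructor
  · rintro ⟨h1, h2, h4, h5, h6, h7, h3⟩
    exact ⟨fun x y => not_imp_not.1 (h1 x y), h2, by simpa only [Nat.lt_succ_iff] using h3,
      h4, h5, h6, h7⟩
  · rintro ⟨h1, h2, h3, h4, h5, h6, h7⟩
    exact ⟨fun x y => mt (h1 x y), h2, h4, h5, h6, h7, by simpa only [Nat.lt_succ_iff] using h3⟩

theorem model_IQ2_iff : M ⊨ IQ2 ↔ IsIQ M ∧ IsSemiring M := by
  rw [IQ2, Theory.model_union_iff, model_IQ_iff]
  refine and_congr_right fun _ => ?_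
  simp only [Theory.model_iff, Set.mem_insert_iff, Set.mem_singleton_iff, forall_eq_or_imp,
    forall_eq]
  have key : ∀ φ : LNT.Sentence, M ⊨ φ ↔ BoundedFormula.Realize φ (default : Empty → M) default :=
    fun _ => Iff.rfl
  simp only [key, leftDistrib, addAssoc, mulAssoc, addComm, mulComm, addRightCancel, nonneg,
    noZeroDivisors, BoundedFormula.realize_all, BoundedFormula.realize_imp,
    BoundedFormula.realize_bdEqual, BoundedFormula.realize_inf, BoundedFormula.realize_sup,
    realize_add, realize_mul, realize_zero]
  constructor
  · rintro ⟨h1, h2, h3, h4, h5, h6, h7, h8⟩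
    exact ⟨h1, h2, h3, h4, h5, h6, h7, h8⟩
  · rintro ⟨h1, h2, h3, h4, h5, h6, h7, h8⟩
    exact ⟨h1, h2, h3, h4, h5, h6, h7, h8⟩

end LNT

/-! ## A definable class with the commutative-semiring axioms -/

namespace LNT

section Shortening

variable {M : Type} [LNT.Structure M]

/-- A class with `0` that is closed under the functions. -/
structure IsClosed (P : M → Prop) : Prop where
  zero : P 0
  succ : ∀ x, P x → P (succFun x)
  add : ∀ x y, P x → P y → P (x + y)
  mul : ∀ x y, P x → P y → P (x * y)

def AddAssoc (z : M) : Prop := ∀ x y : M, x + y + z = x + (y + z)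

def Distrib (z : M) : Prop :=
  AddAssoc z ∧ ∀ x : M, AddAssoc x → AddAssoc (x * z) ∧ ∀ y, x * (y + z) = x * y + x * z

def MulAssoc (z : M) : Prop :=
  Distrib z ∧ ∀ x y : M, AddAssoc x → Distrib y → Distrib (y * z) ∧ x * y * z = x * (y * z)

def Regular (z : M) : Prop :=
  MulAssoc z ∧ 0 + z = z ∧ (∀ x : M, succFun x + z = succFun (x + z)) ∧ 0 * z = 0 ∧
    (∀ x y : M, x + z = y + z → x = y) ∧ (z = 0 ∨ ∃ y, z = succFun y)

def AddComm (z : M) : Prop := Regular z ∧ ∀ x : M, Regular x → x + z = z + x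

def SuccMul (z : M) : Prop := AddComm z ∧ ∀ x : M, AddComm x → succFun x * z = x * z + z

def MulComm (z : M) : Prop := SuccMul z ∧ ∀ x : M, SuccMul x → x * z = z * x

def AddClosed (z : M) : Prop := MulComm z ∧ ∀ x : M, MulComm x → MulComm (x + z)

def MulClosed (z : M) : Prop := AddClosed z ∧ ∀ x : M, AddClosed x → AddClosed (x * z)

variable (h : IsIQ M)

include h

theorem AddAssoc.zero : AddAssoc (0 : M) := fun x y => by rw [h.add_zero, h.add_zero]

theorem AddAssoc.succ {z : M} (hz : AddAssoc z) : AddAssoc (succFun z) := fun x y => by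
  rw [h.add_succ, h.add_succ, h.add_succ, hz]

omit h in
theorem AddAssoc.add {z w : M} (hz : AddAssoc z) (hw : AddAssoc w) : AddAssoc (z + w) :=
  fun x y => by rw [← hw, hz, hw, hw]

theorem Distrib.zero : Distrib (0 : M) :=
  ⟨.zero h, fun x _ => ⟨by rw [h.mul_zero]; exact .zero h,
    fun y => by rw [h.add_zero, h.mul_zero, h.add_zero]⟩⟩

theorem Distrib.succ {z : M} (hz : Distrib z) : Distrib (succFun z) :=
  ⟨hz.1.succ h, fun x hx => ⟨by rw [h.mul_succ]; exact (hz.2 x hx).1.add hx,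
    fun y => by rw [h.add_succ, h.mul_succ, h.mul_succ, (hz.2 x hx).2, hx]⟩⟩

omit h in
theorem Distrib.add {z w : M} (hz : Distrib z) (hw : Distrib w) : Distrib (z + w) :=
  ⟨hz.1.add hw.1, fun x hx =>
    ⟨by rw [(hw.2 x hx).2]; exact (hz.2 x hx).1.add (hw.2 x hx).1,
      fun y => by rw [← hw.1, (hw.2 x hx).2, (hw.2 x hx).2, (hz.2 x hx).2, (hw.2 x hx).1]⟩⟩

theorem MulAssoc.zero : MulAssoc (0 : M) :=
  ⟨.zero h, fun x y _ _ => ⟨by rw [h.mul_zero]; exact .zero h, by simp only [h.mul_zero]⟩⟩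

theorem MulAssoc.succ {z : M} (hz : MulAssoc z) : MulAssoc (succFun z) :=
  ⟨hz.1.succ h, fun x y hx hy => ⟨by rw [h.mul_succ]; exact (hz.2 x y hx hy).1.add hy,
    by rw [h.mul_succ, h.mul_succ, (hy.2 x hx).2, (hz.2 x y hx hy).2]⟩⟩

omit h in
theorem MulAssoc.add {z w : M} (hz : MulAssoc z) (hw : MulAssoc w) : MulAssoc (z + w) :=
  ⟨hz.1.add hw.1, fun x y hx hy => by
    have e := (hw.1.2 y hy.1).2 z
    refine ⟨e ▸ (hz.2 x y hx hy).1.add (hw.2 x y hx hy).1, ?_⟩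
    rw [(hw.1.2 _ (hy.2 x hx).1).2, e, ((hw.2 x y hx hy).1.2 x hx).2, (hz.2 x y hx hy).2,
      (hw.2 x y hx hy).2]⟩

omit h in
theorem MulAssoc.mul {z w : M} (hz : MulAssoc z) (hw : MulAssoc w) : MulAssoc (z * w) :=
  ⟨(hw.2 z z hz.1.1 hz.1).1, fun x y hx hy => by
    have e := (hw.2 y z hy.1 hz.1).2
    have hyz := (hz.2 x y hx hy).1
    refine ⟨e ▸ (hw.2 x _ hx hyz).1, ?_⟩
    rw [← (hw.2 _ z (hy.2 x hx).1 hz.1).2, (hz.2 x y hx hy).2, (hw.2 x _ hx hyz).2, e]⟩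

theorem Regular.zero : Regular (0 : M) :=
  ⟨.zero h, h.add_zero 0, fun x => by rw [h.add_zero, h.add_zero], h.mul_zero 0,
    fun x y => by rw [h.add_zero, h.add_zero]; exact id, .inl rfl⟩

theorem Regular.succ {z : M} (hz : Regular z) : Regular (succFun z) := by
  obtain ⟨h1, h2, h3, h4, h5, -⟩ := hz
  refine ⟨h1.succ h, by rw [h.add_succ, h2], fun x => by rw [h.add_succ, h.add_succ, h3],
    by rw [h.mul_succ, h4, h.add_zero], fun x y e => ?_, .inr ⟨z, rfl⟩⟩
  rw [h.add_succ, h.add_succ] at e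
  exact h5 x y (h.succ_inj _ _ e)

theorem AddComm.zero : AddComm (0 : M) :=
  ⟨.zero h, fun x hx => by rw [h.add_zero, hx.2.1]⟩

theorem AddComm.succ {z : M} (hz : AddComm z) : AddComm (succFun z) :=
  ⟨hz.1.succ h, fun x hx => by rw [h.add_succ, hz.2 x hx, hx.2.2.1]⟩

theorem SuccMul.zero : SuccMul (0 : M) :=
  ⟨.zero h, fun x _ => by rw [h.mul_zero, h.mul_zero, h.add_zero]⟩

theorem SuccMul.succ {z : M} (hz : SuccMul z) : SuccMul (succFun z) :=
  ⟨hz.1.succ h, fun x hx => by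
    rw [h.mul_succ, h.mul_succ, h.add_succ, h.add_succ, hz.2 x hx, hx.1.1.1.1, hz.1.1.1.1.1,
      hx.2 z hz.1.1]⟩

theorem MulComm.zero : MulComm (0 : M) :=
  ⟨.zero h, fun x hx => by rw [h.mul_zero, hx.1.1.2.2.2.1]⟩

theorem MulComm.succ {z : M} (hz : MulComm z) : MulComm (succFun z) :=
  ⟨hz.1.succ h, fun x hx => by rw [h.mul_succ, hz.2 x hx, hx.2 z hz.1.1]⟩

omit h in
theorem MulComm.mulAssoc {z : M} (hz : MulComm z) : MulAssoc z := hz.1.1.1.1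

theorem AddClosed.zero : AddClosed (0 : M) :=
  ⟨.zero h, fun x hx => by rwa [h.add_zero]⟩

theorem AddClosed.succ {z : M} (hz : AddClosed z) : AddClosed (succFun z) :=
  ⟨hz.1.succ h, fun x hx => by rw [h.add_succ]; exact (hz.2 x hx).succ h⟩

omit h in
theorem AddClosed.add {z w : M} (hz : AddClosed z) (hw : AddClosed w) : AddClosed (z + w) :=
  ⟨hw.2 z hz.1, fun x hx => by rw [← hw.1.mulAssoc.1.1]; exact hw.2 _ (hz.2 x hx)⟩

theorem isClosed_mulClosed : IsClosed (MulClosed (M := M)) where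
  zero := ⟨.zero h, fun x _ => by rw [h.mul_zero]; exact .zero h⟩
  succ z hz := ⟨hz.1.succ h, fun x hx => by rw [h.mul_succ]; exact (hz.2 x hx).add hx⟩
  add z w hz hw := ⟨hz.1.add hw.1, fun x hx => by
    rw [(hw.1.1.mulAssoc.1.2 x hx.1.mulAssoc.1.1).2]; exact (hz.2 x hx).add (hw.2 x hx)⟩
  mul z w hz hw := ⟨hw.2 z hz.1, fun x hx => by
    rw [← (hw.1.1.mulAssoc.2 x z hx.1.mulAssoc.1.1 hz.1.1.mulAssoc.1).2]
    exact hw.2 _ (hz.2 x hx)⟩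

end Shortening

/-! ### Substructures -/

section Substructure

variable {M : Type} [LNT.Structure M]

/-- The substructure on a closed class. -/
def IsClosed.substructure {P : M → Prop} (hP : IsClosed P) : LNT.Substructure M where
  carrier := {x | P x}
  fun_mem f x hx := by
    cases f with
    | zero => exact (funMap_zero x).symm ▸ hP.zero
    | succ => exact (funMap_succ x).symm ▸ hP.succ _ (hx 0)
    | add => exact (funMap_add x).symm ▸ hP.add _ _ (hx 0) (hx 1)
    | mul => exact (funMap_mul x).symm ▸ hP.mul _ _ (hx 0) (hx 1)

variable {S : LNT.Substructure M}

theorem coe_zero : ((0 : S) : M) = 0 := funMap_zero _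

theorem coe_succ (x : S) : (succFun x : S) = succFun (x : M) := funMap_succ _

theorem coe_add (x y : S) : ((x + y : S) : M) = x + y := funMap_add _

theorem coe_mul (x y : S) : ((x * y : S) : M) = x * y := funMap_mul _

theorem coe_leRel (x y : S) : leRel x y ↔ leRel (x : M) (y : M) :=
  relMap_le fun i => ((![x, y] i : S) : M)

theorem coe_num (n : ℕ) : (num S n : M) = num M n := by
  induction n with
  | zero => exact coe_zero
  | succ n ih => rw [num, num, coe_succ, ih]

theorem IsIQ.substructure (h : IsIQ M) (S : LNT.Substructure M) : IsIQ S where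
  succ_inj x y e := Subtype.ext (h.succ_inj _ _ (by rw [← coe_succ, ← coe_succ, e]))
  succ_ne_zero x e := h.succ_ne_zero x (by rw [← coe_succ, e, coe_zero])
  le_iff n x := by simp only [coe_leRel, coe_num, h.le_iff, Subtype.ext_iff]
  add_zero x := Subtype.ext (by rw [coe_add, coe_zero, h.add_zero])
  add_succ x y := Subtype.ext (by simp only [coe_add, coe_succ, h.add_succ])
  mul_zero x := Subtype.ext (by rw [coe_mul, coe_zero, h.mul_zero])
  mul_succ x y := Subtype.ext (by simp only [coe_mul, coe_add, coe_succ, h.mul_succ])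

theorem IsSemiring.substructure (h : IsSemiring M) (S : LNT.Substructure M) : IsSemiring S where
  left_distrib x y z := Subtype.ext (by simp only [coe_add, coe_mul, h.left_distrib])
  add_assoc x y z := Subtype.ext (by simp only [coe_add, h.add_assoc])
  mul_assoc x y z := Subtype.ext (by simp only [coe_mul, h.mul_assoc])
  add_comm x y := Subtype.ext (by rw [coe_add, coe_add, h.add_comm])
  mul_comm x y := Subtype.ext (by rw [coe_mul, coe_mul, h.mul_comm])
  add_right_cancel x y z e :=
    Subtype.ext (h.add_right_cancel _ _ z (by rw [← coe_add, ← coe_add, e]))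
  eq_zero_of_add x y e := by
    simpa only [Subtype.ext_iff, coe_zero] using
      h.eq_zero_of_add (x : M) y (by rw [← coe_add, e, coe_zero])
  eq_zero_of_mul x y e := by
    simpa only [Subtype.ext_iff, coe_zero] using
      h.eq_zero_of_mul (x : M) y (by rw [← coe_mul, e, coe_zero])

theorem isSemiring_mulClosed (h : IsIQ M) : IsSemiring (isClosed_mulClosed h).substructure where
  left_distrib x y z := Subtype.ext (by
    simp only [coe_add, coe_mul]
    exact (z.2.1.1.mulAssoc.1.2 _ x.2.1.1.mulAssoc.1.1).2 _)
  add_assoc x y z := Subtype.ext (by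
    simp only [coe_add]
    exact z.2.1.1.mulAssoc.1.1 _ _)
  mul_assoc x y z := Subtype.ext (by
    simp only [coe_mul]
    exact (z.2.1.1.mulAssoc.2 _ _ x.2.1.1.mulAssoc.1.1 y.2.1.1.mulAssoc.1).2)
  add_comm x y := Subtype.ext (by
    rw [coe_add, coe_add]
    exact y.2.1.1.1.1.2 _ x.2.1.1.1.1.1)
  mul_comm x y := Subtype.ext (by
    rw [coe_mul, coe_mul]
    exact y.2.1.1.2 _ x.2.1.1.1)
  add_right_cancel x y z e := Subtype.ext (z.2.1.1.1.1.1.2.2.2.2.1 _ _ (by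
    rw [← coe_add, ← coe_add, e]))
  eq_zero_of_add x y e := by
    have e' : (x : M) + y = 0 := by rw [← coe_add, e, coe_zero]
    simp only [Subtype.ext_iff, coe_zero]
    obtain hy | ⟨y', hy⟩ := y.2.1.1.1.1.1.2.2.2.2.2
    · rw [hy, h.add_zero] at e'
      exact ⟨e', hy⟩
    · rw [hy, h.add_succ] at e'
      exact (h.succ_ne_zero _ e').elim
  eq_zero_of_mul x y e := by
    have e' : (x : M) * y = 0 := by rw [← coe_mul, e, coe_zero]
    simp only [Subtype.ext_iff, coe_zero]
    obtain hy | ⟨y', hy⟩ := y.2.1.1.1.1.1.2.2.2.2.2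
    · exact .inr hy
    obtain hx | ⟨x', hx⟩ := x.2.1.1.1.1.1.2.2.2.2.2
    · exact .inl hx
    rw [hy, h.mul_succ, hx, h.add_succ] at e'
    exact (h.succ_ne_zero _ e').elim

end Substructure

/-! ### Definability -/

section Definability

variable {α : Type}

/-- Universal quantification over one variable. -/
noncomputable def forallF (φ : LNT.Formula (α ⊕ Fin 1)) : LNT.Formula α := Formula.iAlls (Fin 1) φ

/-- The formula `φ(t)`. -/
def instantiate (φ : LNT.Formula (Fin 1)) (t : LNT.Term α) : LNT.Formula α :=
  BoundedFormula.subst φ fun _ => t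

variable {M : Type} [LNT.Structure M] (v : α → M)

@[simp] theorem realize_forallF (φ : LNT.Formula (α ⊕ Fin 1)) :
    (forallF φ).Realize v ↔ ∀ x : M, φ.Realize (Sum.elim v fun _ => x) := by
  rw [forallF, Formula.realize_iAlls]
  exact ⟨fun H x => H _, fun H i => by
    have e : (fun _ => i 0) = i := funext fun j => by rw [Subsingleton.elim j 0]
    exact e ▸ H (i 0)⟩

@[simp] theorem realize_instantiate (φ : LNT.Formula (Fin 1)) (t : LNT.Term α) :
    (instantiate φ t).Realize v ↔ φ.Realize fun _ => t.realize v :=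
  BoundedFormula.realize_subst

noncomputable def addAssocF : LNT.Formula (Fin 1) :=
  let z := Term.var (Sum.inl (Sum.inl 0))
  let x := Term.var (Sum.inl (Sum.inr 0))
  let y := Term.var (Sum.inr 0)
  forallF (forallF (Term.equal (add (add x y) z) (add x (add y z))))

noncomputable def distribF : LNT.Formula (Fin 1) :=
  addAssocF ⊓ forallF ((instantiate addAssocF (Term.var (Sum.inr 0))).imp
    (instantiate addAssocF (mul (Term.var (Sum.inr 0)) (Term.var (Sum.inl 0))) ⊓
      let z := Term.var (Sum.inl (Sum.inl 0))
      let x := Term.var (Sum.inl (Sum.inr 0))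
      let y := Term.var (Sum.inr 0)
      forallF (Term.equal (mul x (add y z)) (add (mul x y) (mul x z)))))

noncomputable def mulAssocF : LNT.Formula (Fin 1) :=
  let z := Term.var (Sum.inl (Sum.inl 0))
  let x := Term.var (Sum.inl (Sum.inr 0))
  let y := Term.var (Sum.inr 0)
  distribF ⊓ forallF (forallF ((instantiate addAssocF x).imp ((instantiate distribF y).imp
    (instantiate distribF (mul y z) ⊓ Term.equal (mul (mul x y) z) (mul x (mul y z))))))

noncomputable def regularF : LNT.Formula (Fin 1) :=
  let z := Term.var 0
  let z₁ := Term.var (Sum.inl 0)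
  let x₁ := Term.var (Sum.inr 0)
  let z₂ := Term.var (Sum.inl (Sum.inl 0))
  let x₂ := Term.var (Sum.inl (Sum.inr 0))
  let y₂ := Term.var (Sum.inr 0)
  mulAssocF ⊓ (Term.equal (add zero z) z ⊓
    (forallF (Term.equal (add (succ x₁) z₁) (succ (add x₁ z₁))) ⊓
    (Term.equal (mul zero z) zero ⊓
    (forallF (forallF ((Term.equal (add x₂ z₂) (add y₂ z₂)).imp (Term.equal x₂ y₂))) ⊓
    ((Term.equal z zero).not.imp (forallF (Term.equal z₁ (succ x₁)).not).not)))))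

/-- The formula `φ(z) ∧ ∀ x (φ(x) → ψ(z, x))`. -/
noncomputable def restrict (φ : LNT.Formula (Fin 1)) (ψ : LNT.Formula (Fin 1 ⊕ Fin 1)) :
    LNT.Formula (Fin 1) :=
  φ ⊓ forallF ((instantiate φ (Term.var (Sum.inr 0))).imp ψ)

noncomputable def addCommF : LNT.Formula (Fin 1) :=
  let z := Term.var (Sum.inl 0)
  let x := Term.var (Sum.inr 0)
  restrict regularF (Term.equal (add x z) (add z x))

noncomputable def succMulF : LNT.Formula (Fin 1) :=
  let z := Term.var (Sum.inl 0)
  let x := Term.var (Sum.inr 0)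
  restrict addCommF (Term.equal (mul (succ x) z) (add (mul x z) z))

noncomputable def mulCommF : LNT.Formula (Fin 1) :=
  let z := Term.var (Sum.inl 0)
  let x := Term.var (Sum.inr 0)
  restrict succMulF (Term.equal (mul x z) (mul z x))

noncomputable def addClosedF : LNT.Formula (Fin 1) :=
  restrict mulCommF (instantiate mulCommF (add (Term.var (Sum.inr 0)) (Term.var (Sum.inl 0))))

noncomputable def mulClosedF : LNT.Formula (Fin 1) :=
  restrict addClosedF (instantiate addClosedF (mul (Term.var (Sum.inr 0)) (Term.var (Sum.inl 0))))

theorem realize_addAssocF (z : M) : addAssocF.Realize (fun _ => z) ↔ AddAssoc z := by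
  simp [addAssocF, AddAssoc]

theorem realize_distribF (z : M) : distribF.Realize (fun _ => z) ↔ Distrib z := by
  simp [distribF, Distrib, realize_addAssocF]

theorem realize_mulAssocF (z : M) : mulAssocF.Realize (fun _ => z) ↔ MulAssoc z := by
  simp [mulAssocF, MulAssoc, realize_addAssocF, realize_distribF]

theorem realize_regularF (z : M) : regularF.Realize (fun _ => z) ↔ Regular z := by
  simp [regularF, Regular, realize_mulAssocF, Formula.realize_not, or_iff_not_imp_left]

@[simp] theorem realize_restrict (φ : LNT.Formula (Fin 1)) (ψ : LNT.Formula (Fin 1 ⊕ Fin 1))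
    (z : M) : (restrict φ ψ).Realize (fun _ => z) ↔ φ.Realize (fun _ => z) ∧
      ∀ x : M, φ.Realize (fun _ => x) → ψ.Realize (Sum.elim (fun _ => z) fun _ => x) := by
  simp [restrict]

theorem realize_addCommF (z : M) : addCommF.Realize (fun _ => z) ↔ AddComm z := by
  simp [addCommF, AddComm, realize_regularF]

theorem realize_succMulF (z : M) : succMulF.Realize (fun _ => z) ↔ SuccMul z := by
  simp [succMulF, SuccMul, realize_addCommF]

theorem realize_mulCommF (z : M) : mulCommF.Realize (fun _ => z) ↔ MulComm z := by
  simp [mulCommF, MulComm, realize_succMulF]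

theorem realize_addClosedF (z : M) : addClosedF.Realize (fun _ => z) ↔ AddClosed z := by
  simp [addClosedF, AddClosed, realize_mulCommF]

theorem realize_mulClosedF (z : M) : mulClosedF.Realize (fun _ => z) ↔ MulClosed z := by
  simp [mulClosedF, MulClosed, realize_addClosedF]

end Definability

end LNT

/-! ## Strings as `2 × 2` matrices -/

namespace StringMatrix

section Words

variable {R : Type} [CommSemiring R]

/-- The matrix of a letter. -/
def letter : Bool → Matrix (Fin 2) (Fin 2) R
  | false => !![1, 0; 1, 1]
  | true => !![1, 1; 0, 1]

/-- The matrix of a string. -/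
def word (l : List Bool) : Matrix (Fin 2) (Fin 2) R := (l.map letter).prod

@[simp] theorem word_nil : word [] = (1 : Matrix (Fin 2) (Fin 2) R) := rfl

@[simp] theorem word_cons (b : Bool) (l : List Bool) :
    word (b :: l) = (letter b * word l : Matrix (Fin 2) (Fin 2) R) := by simp [word]

theorem word_append (l l' : List Bool) :
    word (l ++ l') = (word l * word l' : Matrix (Fin 2) (Fin 2) R) := by simp [word]

/-- The matrices of determinant `1` other than the identity. -/
def InK (A : Matrix (Fin 2) (Fin 2) R) : Prop := A ≠ 1 ∧ A 0 0 * A 1 1 = 1 + A 0 1 * A 1 0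

/-- The entries of a matrix, row by row. -/
def entries (A : Matrix (Fin 2) (Fin 2) R) : Fin 4 → R := ![A 0 0, A 0 1, A 1 0, A 1 1]

omit [CommSemiring R] in
theorem entries_injective : Function.Injective (entries (R := R)) := by
  intro A B h
  have h' : ∀ i, entries A i = entries B i := congrFun h
  simp only [entries, Fin.forall_fin_succ] at h'
  ext i j
  fin_cases i <;> fin_cases j
  exacts [h'.1, h'.2.1, h'.2.2.1, h'.2.2.2.1]

/-- The relation `A ≼ B` for an order relation `le` on the entries. -/
def Pref (le : R → R → Prop) (A B : Matrix (Fin 2) (Fin 2) R) : Prop :=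
  InK A ∧ InK B ∧ ∃ m : Fin 4, (∀ i, le (entries B i) (entries B m)) ∧
    (A = B ∨ ∃ C, InK C ∧ (∀ i, le (entries A i) (entries B m) ∧ le (entries C i) (entries B m)) ∧
      A * C = B)

theorem letter_mul_false (A : Matrix (Fin 2) (Fin 2) R) :
    letter false * A = !![A 0 0, A 0 1; A 0 0 + A 1 0, A 0 1 + A 1 1] := by
  ext i j; fin_cases i <;> fin_cases j <;> simp [letter, Matrix.mul_apply, Fin.sum_univ_two]

theorem letter_mul_true (A : Matrix (Fin 2) (Fin 2) R) :
    letter true * A = !![A 0 0 + A 1 0, A 0 1 + A 1 1; A 1 0, A 1 1] := by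
  ext i j; fin_cases i <;> fin_cases j <;> simp [letter, Matrix.mul_apply, Fin.sum_univ_two]

theorem mul_letter_false (A : Matrix (Fin 2) (Fin 2) R) :
    A * letter false = !![A 0 0 + A 0 1, A 0 1; A 1 0 + A 1 1, A 1 1] := by
  ext i j; fin_cases i <;> fin_cases j <;> simp [letter, Matrix.mul_apply, Fin.sum_univ_two]

theorem mul_letter_true (A : Matrix (Fin 2) (Fin 2) R) :
    A * letter true = !![A 0 0, A 0 0 + A 0 1; A 1 0, A 1 0 + A 1 1] := by
  ext i j; fin_cases i <;> fin_cases j <;> simp [letter, Matrix.mul_apply, Fin.sum_univ_two]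

omit [CommSemiring R] in
theorem matrix_eq_iff {a b c d : R} {A : Matrix (Fin 2) (Fin 2) R} :
    !![a, b; c, d] = A ↔ a = A 0 0 ∧ b = A 0 1 ∧ c = A 1 0 ∧ d = A 1 1 := by
  rw [← Matrix.ext_iff]
  simp [Fin.forall_fin_two, and_assoc]

section Cancel

variable [IsCancelAdd R]

theorem mul_letter_injective (b : Bool) {A B : Matrix (Fin 2) (Fin 2) R}
    (h : A * letter b = B * letter b) : A = B := by
  cases b
  · rw [mul_letter_false, mul_letter_false, matrix_eq_iff] at h
    obtain ⟨h1, h2, h3, h4⟩ := h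
    simp only [Matrix.of_apply, Matrix.cons_val', Matrix.cons_val_zero, Matrix.cons_val_one,
      Matrix.cons_val_fin_one] at h1 h2 h3 h4
    rw [h2, add_left_inj] at h1
    rw [h4, add_left_inj] at h3
    ext i j; fin_cases i <;> fin_cases j <;> assumption
  · rw [mul_letter_true, mul_letter_true, matrix_eq_iff] at h
    obtain ⟨h1, h2, h3, h4⟩ := h
    simp only [Matrix.of_apply, Matrix.cons_val', Matrix.cons_val_zero, Matrix.cons_val_one,
      Matrix.cons_val_fin_one] at h1 h2 h3 h4
    rw [h1, add_right_inj] at h2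
    rw [h3, add_right_inj] at h4
    ext i j; fin_cases i <;> fin_cases j <;> assumption

theorem letter_mul_injective (b : Bool) {A B : Matrix (Fin 2) (Fin 2) R}
    (h : letter b * A = letter b * B) : A = B := by
  cases b
  · rw [letter_mul_false, letter_mul_false, matrix_eq_iff] at h
    obtain ⟨h1, h2, h3, h4⟩ := h
    simp only [Matrix.of_apply, Matrix.cons_val', Matrix.cons_val_zero, Matrix.cons_val_one,
      Matrix.cons_val_fin_one] at h1 h2 h3 h4
    rw [h1, add_right_inj] at h3
    rw [h2, add_right_inj] at h4
    ext i j; fin_cases i <;> fin_cases j <;> assumption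
  · rw [letter_mul_true, letter_mul_true, matrix_eq_iff] at h
    obtain ⟨h1, h2, h3, h4⟩ := h
    simp only [Matrix.of_apply, Matrix.cons_val', Matrix.cons_val_zero, Matrix.cons_val_one,
      Matrix.cons_val_fin_one] at h1 h2 h3 h4
    rw [h3, add_left_inj] at h1
    rw [h4, add_left_inj] at h2
    ext i j; fin_cases i <;> fin_cases j <;> assumption

variable (hR : ∀ x y : R, x + y = 0 → x = 0)
include hR

theorem mul_letter_false_ne {A B : Matrix (Fin 2) (Fin 2) R} (hA : A 0 0 ≠ 0) :
    A * letter false ≠ B * letter true := by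
  intro h
  rw [mul_letter_false, mul_letter_true, matrix_eq_iff] at h
  obtain ⟨h1, h2, -, -⟩ := h
  simp only [Matrix.of_apply, Matrix.cons_val', Matrix.cons_val_zero, Matrix.cons_val_one,
    Matrix.cons_val_fin_one] at h1 h2
  rw [← h1, add_comm (A 0 0), add_assoc, left_eq_add] at h2
  exact hA (hR _ _ h2)

theorem letter_mul_false_ne {A B : Matrix (Fin 2) (Fin 2) R} (hB : B 0 0 ≠ 0) :
    letter false * A ≠ letter true * B := by
  intro h
  rw [letter_mul_false, letter_mul_true, matrix_eq_iff] at h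
  obtain ⟨h1, -, h3, -⟩ := h
  simp only [Matrix.of_apply, Matrix.cons_val', Matrix.cons_val_zero, Matrix.cons_val_one,
    Matrix.cons_val_fin_one] at h1 h3
  rw [← h3, add_left_comm, left_eq_add] at h1
  exact hB (hR _ _ h1)

end Cancel

end Words

/-! ### Standard matrices -/

theorem word_zero_zero_ne (l : List Bool) : (word l : Matrix (Fin 2) (Fin 2) ℕ) 0 0 ≠ 0 := by
  induction l with
  | nil => simp
  | cons b l ih => cases b <;> simp [letter_mul_false, letter_mul_true, ih]

theorem word_det {R : Type} [CommSemiring R] (l : List Bool) :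
    (word l : Matrix (Fin 2) (Fin 2) R) 0 0 * (word l : Matrix (Fin 2) (Fin 2) R) 1 1 =
      1 + (word l : Matrix (Fin 2) (Fin 2) R) 0 1 * (word l : Matrix (Fin 2) (Fin 2) R) 1 0 := by
  induction l with
  | nil => simp
  | cons b l ih =>
    cases b
    · simp only [word_cons, letter_mul_false, Matrix.of_apply, Matrix.cons_val',
        Matrix.cons_val_zero, Matrix.cons_val_one, Matrix.cons_val_fin_one, mul_add, ih]
      ring
    · simp only [word_cons, letter_mul_true, Matrix.of_apply, Matrix.cons_val',
        Matrix.cons_val_zero, Matrix.cons_val_one, Matrix.cons_val_fin_one, add_mul, ih]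
      ring

theorem word_injective : Function.Injective (word : List Bool → Matrix (Fin 2) (Fin 2) ℕ) := by
  have hR : ∀ x y : ℕ, x + y = 0 → x = 0 := fun x y h => by omega
  have hne : ∀ b l, (word (b :: l) : Matrix (Fin 2) (Fin 2) ℕ) ≠ 1 := by
    intro b l h
    have h0 := word_zero_zero_ne l
    have hd := word_det (R := ℕ) l
    have h' := fun i j => congrFun (congrFun h i) j
    simp only [Fin.forall_fin_two] at h'
    cases b
    · simp [letter_mul_false] at h'
      omega
    · simp [letter_mul_true] at h'
      obtain ⟨⟨_, _, h3⟩, _, h4⟩ := h'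
      omega
  intro l
  induction l with
  | nil =>
    rintro (_ | ⟨b, l⟩) h
    · rfl
    · exact (hne b l h.symm).elim
  | cons b l ih =>
    rintro (_ | ⟨b', l'⟩) h
    · exact (hne b l h).elim
    rw [word_cons, word_cons] at h
    cases b <;> cases b'
    · rw [ih (letter_mul_injective _ h)]
    · exact (letter_mul_false_ne hR (word_zero_zero_ne l') h).elim
    · exact (letter_mul_false_ne hR (word_zero_zero_ne l) h.symm).elim
    · rw [ih (letter_mul_injective _ h)]

theorem exists_word (n : ℕ) : ∀ a b c d : ℕ, a + b + c + d ≤ n → a * d = 1 + b * c →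
    ∃ l, word l = !![a, b; c, d] := by
  induction n with
  | zero =>
    intro a b c d h hd
    obtain rfl : a = 0 := by omega
    omega
  | succ n ih =>
    intro a b c d h hd
    have ha : a ≠ 0 := by rintro rfl; omega
    have hd0 : d ≠ 0 := by rintro rfl; omega
    by_cases h1 : a ≤ c ∧ b ≤ d
    · obtain ⟨⟨c, rfl⟩, ⟨d, rfl⟩⟩ := h1.imp Nat.exists_eq_add_of_le Nat.exists_eq_add_of_le
      obtain ⟨l, hl⟩ := ih a b c d (by omega) (by linarith)
      exact ⟨false :: l, by rw [word_cons, hl, letter_mul_false]; simp⟩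
    by_cases h2 : c ≤ a ∧ d ≤ b
    · obtain ⟨⟨a, rfl⟩, ⟨b, rfl⟩⟩ := h2.imp Nat.exists_eq_add_of_le Nat.exists_eq_add_of_le
      obtain ⟨l, hl⟩ := ih a b c d (by omega) (by linarith)
      exact ⟨true :: l, by rw [word_cons, hl, letter_mul_true]; simp [add_comm]⟩
    obtain h3 | h3 : (a < c ∧ d < b) ∨ (c < a ∧ b < d) := by omega
    · have := Nat.mul_le_mul h3.1.le h3.2.le
      linarith
    · have := Nat.mul_le_mul h3.1 h3.2
      obtain ⟨rfl, rfl⟩ : b = 0 ∧ c = 0 := by constructor <;> linarith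
      obtain ⟨rfl, rfl⟩ := mul_eq_one.1 (hd.trans (by simp))
      exact ⟨[], by rw [word_nil, Matrix.one_fin_two]⟩

theorem InK.exists_word {A : Matrix (Fin 2) (Fin 2) ℕ} (h : InK A) : ∃ l ≠ [], word l = A := by
  obtain ⟨l, hl⟩ := StringMatrix.exists_word _ (A 0 0) (A 0 1) (A 1 0) (A 1 1) le_rfl h.2
  rw [← Matrix.eta_fin_two] at hl
  refine ⟨l, ?_, hl⟩
  rintro rfl
  exact h.1 hl.symm

theorem inK_word {l : List Bool} (h : l ≠ []) : InK (word l : Matrix (Fin 2) (Fin 2) ℕ) :=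
  ⟨fun e => h (word_injective e), word_det l⟩

theorem exists_entry_max (A : Matrix (Fin 2) (Fin 2) ℕ) :
    ∃ m : Fin 4, ∀ i j, A i j ≤ entries A m := by
  obtain ⟨m, hm⟩ := Finite.exists_max (entries A)
  refine ⟨m, fun i j => ?_⟩
  fin_cases i <;> fin_cases j
  exacts [hm 0, hm 1, hm 2, hm 3]

theorem le_mul_left {A C : Matrix (Fin 2) (Fin 2) ℕ} (hC : C 0 0 * C 1 1 = 1 + C 0 1 * C 1 0)
    {n : ℕ} (h : ∀ i j, (A * C) i j ≤ n) (i j : Fin 2) : A i j ≤ n := by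
  have hj : ∃ k, C j k ≠ 0 := by
    by_contra! H
    fin_cases j <;> simp_all
  obtain ⟨k, hk⟩ := hj
  calc A i j ≤ A i j * C j k := Nat.le_mul_of_pos_right _ (Nat.pos_of_ne_zero hk)
    _ ≤ (A * C) i k := by
      rw [Matrix.mul_apply]
      exact Finset.single_le_sum (f := fun j => A i j * C j k) (fun _ _ => Nat.zero_le _)
        (Finset.mem_univ j)
    _ ≤ n := h i k

theorem le_mul_right {A C : Matrix (Fin 2) (Fin 2) ℕ} (hA : A 0 0 * A 1 1 = 1 + A 0 1 * A 1 0)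
    {n : ℕ} (h : ∀ i j, (A * C) i j ≤ n) (i j : Fin 2) : C i j ≤ n := by
  have hi : ∃ k, A k i ≠ 0 := by
    by_contra! H
    fin_cases i <;> simp_all
  obtain ⟨k, hk⟩ := hi
  calc C i j ≤ A k i * C i j := Nat.le_mul_of_pos_left _ (Nat.pos_of_ne_zero hk)
    _ ≤ (A * C) k j := by
      rw [Matrix.mul_apply]
      exact Finset.single_le_sum (f := fun i => A k i * C i j) (fun _ _ => Nat.zero_le _)
        (Finset.mem_univ i)
    _ ≤ n := h k j

/-! ### Prefixes of standard strings -/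

section Prefix

variable {R : Type} [CommSemiring R]

/-- A standard matrix, read in `R`. -/
abbrev cast : Matrix (Fin 2) (Fin 2) ℕ →+* Matrix (Fin 2) (Fin 2) R := (Nat.castRingHom R).mapMatrix

theorem cast_word (l : List Bool) : cast (R := R) (word l) = word l := by
  rw [word, map_list_prod, word, List.map_map]
  congr 2
  funext b
  ext i j; cases b <;> fin_cases i <;> fin_cases j <;> simp [letter, cast]

theorem entries_cast (A : Matrix (Fin 2) (Fin 2) ℕ) (i : Fin 4) :
    entries (cast (R := R) A) i = (entries A i : ℕ) := by
  fin_cases i <;> rfl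

variable [CharZero R]

theorem cast_injective : Function.Injective (cast (R := R)) :=
  Matrix.map_injective Nat.cast_injective

theorem inK_cast {A : Matrix (Fin 2) (Fin 2) ℕ} : InK (cast (R := R) A) ↔ InK A := by
  refine and_congr (not_congr ?_) ?_
  · rw [← map_one (cast (R := R)), cast_injective.eq_iff]
  · simp only [cast, RingHom.mapMatrix_apply, Matrix.map_apply, eq_natCast]
    norm_cast

variable {le : R → R → Prop} (hle : ∀ (n : ℕ) (x : R), le x n ↔ ∃ k ≤ n, x = (k : R))
include hle

theorem le_natCast_iff (m n : ℕ) : le (m : R) n ↔ m ≤ n := by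
  rw [hle]
  exact ⟨fun ⟨k, hk, e⟩ => Nat.cast_injective e ▸ hk, fun h => ⟨m, h, rfl⟩⟩

omit [CharZero R] in
theorem exists_cast_of_le {A : Matrix (Fin 2) (Fin 2) R} {n : ℕ} (h : ∀ i, le (entries A i) n) :
    ∃ A', A = cast A' := by
  have h' : ∀ i j, ∃ k : ℕ, A i j = k := fun i j => by
    have := fun m => ((hle n _).1 (h m)).imp fun _ => And.right
    fin_cases i <;> fin_cases j
    exacts [this 0, this 1, this 2, this 3]
  choose A' hA' using h'
  exact ⟨Matrix.of A', Matrix.ext hA'⟩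

theorem pref_word_iff (A : Matrix (Fin 2) (Fin 2) R) (b : Bool) (l : List Bool) :
    Pref le A (word (b :: l)) ↔ ∃ g ∈ l.inits, A = word (b :: g) := by
  simp only [List.mem_inits, ← cast_word (R := R)]
  constructor
  · rintro ⟨hA, hB, m, hm, rfl | ⟨C, hC, hAC, e⟩⟩
    · exact ⟨l, List.prefix_refl l, rfl⟩
    rw [entries_cast] at hAC
    obtain ⟨A, rfl⟩ := exists_cast_of_le hle fun i => (hAC i).1
    obtain ⟨C, rfl⟩ := exists_cast_of_le hle fun i => (hAC i).2
    obtain ⟨u, hu, rfl⟩ := (inK_cast.1 hA).exists_word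
    obtain ⟨v, -, rfl⟩ := (inK_cast.1 hC).exists_word
    rw [← map_mul, ← word_append] at e
    have e' := word_injective (cast_injective e)
    obtain _ | ⟨b', g⟩ := u
    · exact (hu rfl).elim
    rw [List.cons_append, List.cons.injEq] at e'
    exact ⟨g, ⟨v, e'.2⟩, by rw [e'.1]⟩
  · rintro ⟨g, ⟨t, rfl⟩, rfl⟩
    refine ⟨inK_cast.2 (inK_word (by simp)), inK_cast.2 (inK_word (by simp)), ?_⟩
    obtain ⟨m, hm⟩ := exists_entry_max (word (b :: (g ++ t)))
    simp only [entries_cast, le_natCast_iff hle]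
    refine ⟨m, fun i => ?_, ?_⟩
    · fin_cases i <;> exact hm _ _
    obtain rfl | ht := eq_or_ne t []
    · exact .inl (by rw [List.append_nil])
    refine .inr ⟨cast (word t), inK_cast.2 (inK_word ht), ?_, ?_⟩
    · simp only [entries_cast, le_natCast_iff hle]
      rw [← List.cons_append, word_append] at hm ⊢
      have h1 := le_mul_left (word_det t) hm
      have h2 := le_mul_right (word_det (b :: g)) hm
      intro i
      fin_cases i <;> exact ⟨h1 _ _, h2 _ _⟩
    · rw [← map_mul, ← word_append, List.cons_append]

end Prefix

end StringMatrix

/-! ## The interpretations -/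

/-- A definable substructure is the internal model of the relativization to its definition. -/
theorem isInternalModel_relativization {L : FirstOrder.Language.{0, 0}} {M : Type} [L.Structure M]
    {N : L.Formula (Fin 1)} {S : L.Substructure M} (hN : ∀ x, N.Realize (fun _ => x) ↔ x ∈ S) :
    (relativization N).IsInternalModel fun (d : S) (_ : Fin 1) => (d : M) where
  injective _ _ h := Subtype.ext (congrFun h 0)
  dom w := by
    obtain ⟨x, rfl⟩ : ∃ x, w = fun _ => x := ⟨w 0, funext fun i => by rw [Subsingleton.elim i 0]⟩
    exact (hN x).trans
      ⟨fun h => ⟨⟨x, h⟩, rfl⟩, fun ⟨d, hd⟩ => (congrFun hd 0 : (d : M) = x) ▸ d.2⟩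
  eqv ds := by
    rw [relativization, Formula.realize_equal, Subtype.ext_iff]
    rfl
  rel R ds := by
    rw [relativization, Formula.realize_rel]
    rfl
  func f ds d := by
    rw [relativization, Formula.realize_equal, Subtype.ext_iff, eq_comm]
    rfl

namespace LNT

section Semiring

variable {R : Type} [LNT.Structure R]

theorem succFun_eq_add (h : IsIQ R) (x : R) : succFun x = x + succFun 0 := by
  rw [h.add_succ, h.add_zero]

/-- The commutative semiring given by a model of `IQ⁽²⁾`. -/
abbrev commSemiring (h : IsIQ R) (h₂ : IsSemiring R) : CommSemiring R where
  zero := 0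
  one := succFun 0
  add := (· + ·)
  mul := (· * ·)
  add_assoc := h₂.add_assoc
  add_comm := h₂.add_comm
  zero_add x := (h₂.add_comm 0 x).trans (h.add_zero x)
  add_zero := h.add_zero
  mul_assoc := h₂.mul_assoc
  mul_comm := h₂.mul_comm
  zero_mul x := (h₂.mul_comm 0 x).trans (h.mul_zero x)
  mul_zero := h.mul_zero
  one_mul x := by
    refine (h₂.mul_comm (succFun 0) x).trans ?_
    rw [h.mul_succ, h.mul_zero, h₂.add_comm, h.add_zero]
  mul_one x := by
    change x * succFun 0 = x
    rw [h.mul_succ, h.mul_zero, h₂.add_comm, h.add_zero]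
  left_distrib := h₂.left_distrib
  right_distrib x y z := by
    rw [h₂.mul_comm, h₂.left_distrib, h₂.mul_comm z x, h₂.mul_comm z y]
  nsmul := nsmulRec

theorem natCast_eq_num (h : IsIQ R) (h₂ : IsSemiring R) (n : ℕ) :
    (letI := commSemiring h h₂; (n : R)) = num R n := by
  let := commSemiring h h₂
  induction n with
  | zero => exact Nat.cast_zero
  | succ n ih => exact (Nat.cast_succ n).trans ((congrArg (· + 1) ih).trans
      (succFun_eq_add h _).symm)

theorem num_injective (h : IsIQ R) : Function.Injective (num R) := by
  intro m
  induction m with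
  | zero =>
    rintro (_ | n) e
    exacts [rfl, (h.succ_ne_zero _ e.symm).elim]
  | succ m ih =>
    rintro (_ | n) e
    exacts [(h.succ_ne_zero _ e).elim, congrArg _ (ih (h.succ_inj _ _ e))]

end Semiring

end LNT

namespace StringMatrix

open LNT

variable {R : Type} [CommSemiring R]

/-- The matrices with nonzero top left entry. -/
abbrev Carrier (R : Type) [CommSemiring R] : Type := {A : Matrix (Fin 2) (Fin 2) R // A 0 0 ≠ 0}

/-- The matrices with nonzero top left entry as a structure for the language of concatenation. -/
abbrev structureOf [Nontrivial R] [NoZeroDivisors R] (hR : ∀ x y : R, x + y = 0 → x = 0)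
    (le : R → R → Prop) : LBT.Structure (Carrier R) where
  funMap {_} f := match f with
    | .zero => fun _ => ⟨letter false, by simp [letter]⟩
    | .one => fun _ => ⟨letter true, by simp [letter]⟩
    | .conc => fun x => ⟨(x 0).1 * (x 1).1, fun h => by
        rw [Matrix.mul_apply, Fin.sum_univ_two] at h
        exact mul_ne_zero (x 0).2 (x 1).2 (hR _ _ h)⟩
  RelMap {_} r := match r with
    | .pref => fun x => Pref le (x 0).1 (x 1).1

section Model

variable [Nontrivial R] [NoZeroDivisors R] (hR : ∀ x y : R, x + y = 0 → x = 0)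
  (le : R → R → Prop) {α : Type} (v : α → Carrier R)

theorem realize_bit (b : Bool) :
    (letI := structureOf hR le; (LBT.bit b : LBT.Term α).realize v).1 = letter b := by
  cases b <;> rfl

theorem realize_conc (s t : LBT.Term α) :
    (letI := structureOf hR le; (LBT.conc s t).realize v).1 =
      (letI := structureOf hR le; s.realize v).1 * (letI := structureOf hR le; t.realize v).1 :=
  rfl

theorem realize_biteral (b : Bool) (l : List Bool) :
    (letI := structureOf hR le; (LBT.biteral b l : LBT.Term α).realize v).1 = word (b :: l) := by
  have key : ∀ (t : LBT.Term α) (l : List Bool), (letI := structureOf hR le;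
      (l.foldl (fun t c => LBT.conc t (LBT.bit c)) t).realize v).1 =
        (letI := structureOf hR le; t.realize v).1 * word l := by
    intro t l
    induction l generalizing t with
    | nil => exact (mul_one _).symm
    | cons c l ih =>
      rw [List.foldl_cons, ih, realize_conc, realize_bit, word_cons, mul_assoc]
  rw [LBT.biteral, key, realize_bit, word_cons]

theorem realize_pref {n : ℕ} (s t : LBT.Term (α ⊕ Fin n)) (xs : Fin n → Carrier R) :
    (letI := structureOf hR le; (LBT.pref s t).Realize v xs) ↔
      Pref le (letI := structureOf hR le; s.realize (Sum.elim v xs)).1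
        (letI := structureOf hR le; t.realize (Sum.elim v xs)).1 := Iff.rfl

theorem model_IDbar [CharZero R] [IsCancelAdd R]
    (hle : ∀ (n : ℕ) (x : R), le x n ↔ ∃ k ≤ n, x = (k : R)) :
    letI := structureOf hR le; Carrier R ⊨ IDbar := by
  let := structureOf hR le
  have key : ∀ φ : LBT.Sentence, Carrier R ⊨ φ ↔
      BoundedFormula.Realize φ (default : Empty → Carrier R) default := fun _ => Iff.rfl
  rw [Theory.model_iff]
  rintro φ ((rfl | rfl | rfl | rfl | rfl) | ⟨b, l, rfl⟩) <;> rw [key]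
  · simp only [LBT.ax1, BoundedFormula.realize_all, BoundedFormula.realize_bdEqual, Subtype.ext_iff,
      realize_conc, mul_assoc, implies_true]
  · simp only [LBT.ax2, BoundedFormula.realize_all, BoundedFormula.realize_bdEqual, Subtype.ext_iff,
      realize_conc, realize_bit, BoundedFormula.realize_imp, BoundedFormula.realize_not,
      BoundedFormula.realize_inf]
    exact fun x y h => ⟨mt (mul_letter_injective false) h, mt (mul_letter_injective true) h⟩
  · simp only [LBT.ax3, BoundedFormula.realize_all, BoundedFormula.realize_bdEqual, Subtype.ext_iff,
      realize_conc, realize_bit, BoundedFormula.realize_not]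
    exact fun x y => mul_letter_false_ne hR x.2
  · simp only [LBT.ax5, BoundedFormula.realize_all, BoundedFormula.realize_bdEqual, Subtype.ext_iff,
      realize_conc, realize_bit, BoundedFormula.realize_imp, BoundedFormula.realize_not,
      BoundedFormula.realize_inf]
    exact fun x y h => ⟨mt (letter_mul_injective false) h, mt (letter_mul_injective true) h⟩
  · simp only [LBT.ax6, BoundedFormula.realize_all, BoundedFormula.realize_bdEqual, Subtype.ext_iff,
      realize_conc, realize_bit, BoundedFormula.realize_not]
    exact fun x y => letter_mul_false_ne hR y.2
  · simp only [LBT.ax4, BoundedFormula.realize_all, BoundedFormula.realize_iff, realize_pref,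
      realize_bigOr, List.mem_map, exists_exists_and_eq_and, BoundedFormula.realize_bdEqual,
      Subtype.ext_iff, realize_biteral]
    exact fun x => pref_word_iff hle _ b l

end Model

end StringMatrix

namespace StringMatrix

open LNT

variable {M : Type} [LNT.Structure M] {S : LNT.Substructure M}

section Entries

/-- The entries of a matrix over a substructure of `M`, as elements of `M`. -/
def code (A : Matrix (Fin 2) (Fin 2) S) (i : Fin 4) : M := (entries A i : S)

theorem code_injective : Function.Injective (code (S := S)) := fun _ _ h =>
  entries_injective (funext fun i => Subtype.ext (congrFun h i))

variable {α : Type} {v : α → M} {a b : Fin 4 → LNT.Term α}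
  {A B : Matrix (Fin 2) (Fin 2) S}

theorem realize_matEq (ha : ∀ i, (a i).realize v = code A i)
    (hb : ∀ i, (b i).realize v = code B i) : (matEq a b).Realize v ↔ A = B := by
  simp only [matEq, Formula.realize_iInf, Formula.realize_equal, ha, hb]
  exact ⟨fun h => code_injective (funext h), fun h i => h ▸ rfl⟩

/-- The semiring operations of the substructure `S` are those of its first-order structure. -/
structure Compatible (S : LNT.Substructure M) [CommSemiring S] : Prop where
  zero : ((0 : S) : M) = 0
  one : ((1 : S) : M) = succFun 0
  add : ∀ x y : S, ((x + y : S) : M) = (x : M) + y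
  mul : ∀ x y : S, ((x * y : S) : M) = (x : M) * y

variable [CommSemiring S] (hS : Compatible S)

include hS

theorem realize_matId (i : Fin 4) :
    (matId i : LNT.Term α).realize v = code (1 : Matrix (Fin 2) (Fin 2) S) i := by
  fin_cases i <;> simp [matId, code, entries, hS.zero, hS.one]

theorem realize_matZero (i : Fin 4) :
    (matZero i : LNT.Term α).realize v = code (letter false : Matrix (Fin 2) (Fin 2) S) i := by
  fin_cases i <;> simp [matZero, code, entries, letter, hS.zero, hS.one]

theorem realize_matOne (i : Fin 4) :
    (matOne i : LNT.Term α).realize v = code (letter true : Matrix (Fin 2) (Fin 2) S) i := by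
  fin_cases i <;> simp [matOne, code, entries, letter, hS.zero, hS.one]

theorem realize_matMul (ha : ∀ i, (a i).realize v = code A i)
    (hb : ∀ i, (b i).realize v = code B i) (i : Fin 4) :
    (matMul a b i).realize v = code (A * B) i := by
  fin_cases i <;> simp [matMul, code, entries, Matrix.mul_apply, Fin.sum_univ_two, hS.add, hS.mul,
    ha, hb]

theorem realize_inK (ha : ∀ i, (a i).realize v = code A i) : (inK a).Realize v ↔ InK A := by
  rw [inK, Formula.realize_inf, Formula.realize_not, realize_matEq ha (realize_matId hS),
    Formula.realize_equal, InK, Subtype.ext_iff]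
  simp [ha, hS.add, hS.mul, hS.one, code, entries]

end Entries

theorem realize_entriesIn {N : LNT.Formula (Fin 1)}
    (hN : ∀ x : M, N.Realize (fun _ => x) ↔ x ∈ S) {α : Type} (g : Fin 4 → α) (v : α → M) :
    (entriesIn N g).Realize v ↔ ∃ A : Matrix (Fin 2) (Fin 2) S, code A = fun i => v (g i) := by
  simp only [entriesIn, Formula.realize_iInf, Formula.realize_relabel]
  refine (forall_congr' fun i => hN (v (g i))).trans ⟨fun h => ?_, ?_⟩
  · refine ⟨!![⟨_, h 0⟩, ⟨_, h 1⟩; ⟨_, h 2⟩, ⟨_, h 3⟩], funext fun i => ?_⟩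
    fin_cases i <;> rfl
  · rintro ⟨A, hA⟩ i
    rw [← congrFun hA i]
    exact (entries A i).2

theorem realize_matPref [CommSemiring S] (hS : Compatible S) {N : LNT.Formula (Fin 1)}
    (hN : ∀ x : M, N.Realize (fun _ => x) ↔ x ∈ S) (A : Fin 2 → Matrix (Fin 2) (Fin 2) S) :
    (matPref N).Realize (fun p => code (A p.1) p.2) ↔
      Pref (fun x y : S => leRel (x : M) y) (A 0) (A 1) := by
  simp only [matPref, Formula.realize_inf, Formula.realize_iSup, Formula.realize_iInf,
    Formula.realize_sup, Formula.realize_iExs, realize_leF, Term.realize_var, and_assoc]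
  rw [realize_inK hS (A := A 0) fun _ => rfl, realize_inK hS (A := A 1) fun _ => rfl,
    realize_matEq (A := A 0) (B := A 1) (fun _ => rfl) fun _ => rfl]
  refine and_congr_right fun _ => and_congr_right fun _ => exists_congr fun m =>
    and_congr_right fun _ => or_congr_right ⟨?_, ?_⟩
  · rintro ⟨w, hw, h⟩
    obtain ⟨C, hC⟩ := (realize_entriesIn hN _ _).1 hw
    obtain rfl : code C = w := hC
    rw [realize_inK hS (A := C) fun _ => rfl, realize_matEq (A := A 0 * C) (B := A 1)
      (realize_matMul hS (fun _ => rfl) fun _ => rfl) fun _ => rfl] at h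
    exact ⟨C, h⟩
  · rintro ⟨C, h⟩
    refine ⟨code C, (realize_entriesIn hN _ _).2 ⟨C, rfl⟩, ?_⟩
    rw [realize_inK hS (A := C) fun _ => rfl, realize_matEq (A := A 0 * C) (B := A 1)
      (realize_matMul hS (fun _ => rfl) fun _ => rfl) fun _ => rfl]
    exact h

theorem isInternalModel_matrixTranslation [CommSemiring S] [Nontrivial S] [NoZeroDivisors S]
    (hS : Compatible S) {N : LNT.Formula (Fin 1)} (hN : ∀ x : M, N.Realize (fun _ => x) ↔ x ∈ S)
    (hR : ∀ x y : S, x + y = 0 → x = 0) :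
    letI := structureOf hR fun x y : S => leRel (x : M) y
    (matrixTranslation N).IsInternalModel fun A : Carrier S => code A.1 := by
  let := structureOf hR fun x y : S => leRel (x : M) y
  refine ⟨fun A B h => Subtype.ext (code_injective h), fun w => ?_, fun ds => ?_, fun R ds => ?_,
    fun f ds d => ?_⟩
  · have key : ∀ A : Matrix (Fin 2) (Fin 2) S, A 0 0 = 0 ↔ code A 0 = 0 := fun A => by
      rw [← hS.zero, Subtype.ext_iff]
      rfl
    rw [matrixTranslation, Formula.realize_inf, Formula.realize_not, Formula.realize_equal,
      realize_entriesIn hN, Term.realize_var, realize_zero]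
    constructor
    · rintro ⟨⟨A, hA⟩, h⟩
      obtain rfl : code A = w := hA
      exact ⟨⟨A, mt (key A).1 h⟩, rfl⟩
    · rintro ⟨A, rfl⟩
      exact ⟨⟨A.1, rfl⟩, mt (key A.1).2 A.2⟩
  · rw [matrixTranslation, realize_matEq (A := (ds 0).1) (B := (ds 1).1) (fun _ => rfl) fun _ => rfl,
      Subtype.ext_iff]
  · cases R
    exact realize_matPref hS hN fun i => (ds i).1
  · rw [Subtype.ext_iff, eq_comm]
    cases f with
    | zero => exact realize_matEq (fun _ => rfl) (realize_matZero hS)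
    | one => exact realize_matEq (fun _ => rfl) (realize_matOne hS)
    | conc =>
      exact realize_matEq (fun _ => rfl)
        (realize_matMul hS (A := (ds 0).1) (B := (ds 1).1) (fun _ => rfl) fun _ => rfl)

/-- If `N` defines a commutative semiring in every model of `T`, then the translation by matrices
over `N` is an interpretation in `T`. -/
theorem isInterpretation_matrixTranslation {T : LNT.Theory} {N : LNT.Formula (Fin 1)}
    (H : ∀ (M : Type) [LNT.Structure M] [M ⊨ T], IsIQ M ∧ ∃ S : LNT.Substructure M,
      (∀ x : M, N.Realize (fun _ => x) ↔ x ∈ S) ∧ IsSemiring S) :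
    IsInterpretation (matrixTranslation N) IDbar T := by
  refine .of_internalModel fun M _ _ => ?_
  obtain ⟨h, S, hN, h₂⟩ := H M
  have h₁ := h.substructure S
  let := commSemiring h₁ h₂
  have hS : Compatible S :=
    ⟨coe_zero, (coe_succ _).trans (congrArg _ coe_zero), coe_add, coe_mul⟩
  have hR : ∀ x y : S, x + y = 0 → x = 0 := fun x y e => (h₂.eq_zero_of_add x y e).1
  have : CharZero S := ⟨fun m n e => num_injective h₁
    ((natCast_eq_num h₁ h₂ m).symm.trans (e.trans (natCast_eq_num h₁ h₂ n)))⟩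
  have : Nontrivial S := ⟨0, 1, fun e => Nat.zero_ne_one (Nat.cast_injective (R := S)
    (Nat.cast_zero.trans (e.trans Nat.cast_one.symm)))⟩
  have : NoZeroDivisors S := ⟨fun {x y} e => h₂.eq_zero_of_mul x y e⟩
  have : IsRightCancelAdd S := ⟨fun z x y e => h₂.add_right_cancel x y z e⟩
  have : IsCancelAdd S := AddCommMagma.IsRightCancelAdd.toIsCancelAdd S
  let := structureOf hR fun x y : S => leRel (x : M) y
  refine ⟨Carrier S, this, _, isInternalModel_matrixTranslation hS hN hR, ⟨⟨1, ?_⟩⟩, ?_⟩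
  · simp
  · refine model_IDbar hR _ fun n x => ?_
    rw [← coe_leRel]
    have := h₁.le_iff n x
    simp only [← natCast_eq_num h₁ h₂] at this
    exact this

end StringMatrix

theorem mainTheorem5 :
    HasInterpretation 4 IDbar IQ ∧
      IsInterpretation (matrixTranslation ⊤) IDbar IQ2 ∧
      ∃ N : LNT.Formula (Fin 1),
        IsInterpretation (relativization N) IQ2 IQ ∧
          IsInterpretation (matrixTranslation N) IDbar IQ := by
  have key : ∀ (M : Type) [LNT.Structure M] [M ⊨ IQ], LNT.IsIQ M ∧ ∃ S : LNT.Substructure M,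
      (∀ x : M, LNT.mulClosedF.Realize (fun _ => x) ↔ x ∈ S) ∧ LNT.IsSemiring S := fun M _ hM =>
    have h := (LNT.model_IQ_iff M).1 hM
    ⟨h, (LNT.isClosed_mulClosed h).substructure, LNT.realize_mulClosedF, LNT.isSemiring_mulClosed h⟩
  have h₁ := StringMatrix.isInterpretation_matrixTranslation key
  refine ⟨⟨_, h₁⟩, StringMatrix.isInterpretation_matrixTranslation fun M _ hM => ?_, LNT.mulClosedF,
    .of_internalModel fun M _ _ => ?_, h₁⟩
  · obtain ⟨h, h₂⟩ := (LNT.model_IQ2_iff M).1 hM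
    exact ⟨h, ⊤, fun x => iff_of_true (Formula.realize_top.2 trivial) trivial, h₂.substructure ⊤⟩
  · obtain ⟨h, S, hN, h₂⟩ := key M
    exact ⟨S, inferInstance, _, isInternalModel_relativization hN, ⟨0⟩,
      (LNT.model_IQ2_iff S).2 ⟨h.substructure S, h₂⟩⟩
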